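/- **Setting.** Consider a generalized linear model. A response with canonical parameter $\theta$ in an open interval $\Theta$ has density $c(y)\exp\{(y\theta-b(\theta))/\phi\}$ with respect to a fixed reference measure, with dispersion $\phi>0$. Write $\mu=b'$ for the mean function and let $h:D\to\mu(\Theta)$, $D\subseteq\mathbb R$ an open interval, be the strictly monotone inverse link. Put $u=\mu^{-1}\circ h$, let $v=\phi\, b''\circ u$ be the variance function, assumed positive on $D$, and put $w=(h')^2/v$. For each $n$ let $\mathbf z_1,\dots,\mathbf z_n\in\mathbb R^{p_n}$ be known (they may depend on $n$), let $\beta_{0n}\in\mathbb R^{p_n}$ be the true parameter, and let $y_1,\dots,y_n$ be independent, $y_i$ having canonical parameter $u(\mathbf z_i^{\mathsf T}\beta_{0n})$. Let $$S_n(\beta)=\frac1\phi\sum_{i=1}^n \mathbf z_i\,u'(\mathbf z_i^{\mathsf T}\beta)\,[y_i-h(\mathbf z_i^{\mathsf T}\beta)],\qquad F_n(\beta)=\sum_{i=1}^n w(\mathbf z_i^{\mathsf T}\beta)\,\mathbf z_i\mathbf z_i^{\mathsf T}$$ be the score function (the gradient of the log-likelihood) and the Fisher information matrix. **Assumptions.**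 All constants are independent of $n$, and the bounds hold for all large $n$. 1. All eigenvalues of $\frac1n\sum_{i\le n}\mathbf z_i\mathbf z_i^{\mathsf T}$ lie in $[C_{\min},C_{\max}]$ with $0<C_{\min}\le C_{\max}<\infty$. 2. $\max_{i\le n}\|\mathbf z_i\|^2=O(p_n)$ and $\sup_{\|\alpha\|=1}\sum_{i\le n}|\alpha^{\mathsf T}\mathbf z_i|^4=O(n)$. 3. $\mathrm E(e_i^2)$ is bounded uniformly in $i\le n$ and $n$, where $e_i=y_i-h(\mathbf z_i^{\mathsf T}\beta_{0n})$. 4. $\beta_{0n}$ is an interior point of a compact set $\mathcal B_n\subset\mathbb R^{p_n}$ such that $\mathbf z_i^{\mathsf T}\beta\in D$ for all $\beta\in\mathcal B_n$ and $i\le n$, and $\sqrt{p_n/n}=o(\mathrm{dist}(\beta_{0n},\mathbb R^{p_n}\setminus\mathcal B_n))$. 5. On $D$, $u$ is three times and $w$ once continuously differentiable; $h,h',u',u'',u''',w,w'$ are bounded at the points $\mathbf z_i^{\mathsf T}\beta$, uniformly over $\beta\in\mathcal B_n$, $i\le n$ and $n$; and $w(\mathbf z_i^{\mathsf T}\beta_{0n})\ge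 W$ for a constant $W>0$. Let $\hat\beta_n^{(0)}$ be random vectors that are $\sqrt{n/p_n}$-consistent, i.e. $\|\hat\beta_n^{(0)}-\beta_{0n}\|=O_P(\sqrt{p_n/n})$. **Theorem.** (i) If $p_n=o(n)$, then $F_n(\hat\beta_n^{(0)})$ is invertible with probability tending to 1, so that the one-step Fisher scoring estimator $\hat\beta_n^{(1)}=\hat\beta_n^{(0)}+F_n^{-1}(\hat\beta_n^{(0)})S_n(\hat\beta_n^{(0)})$ (a random vector, with any fixed measurable convention where $F_n(\hat\beta_n^{(0)})$ is singular) satisfies $$P\big(F_n(\hat\beta_n^{(0)})(\hat\beta_n^{(1)}-\hat\beta_n^{(0)})=S_n(\hat\beta_n^{(0)})\big)\to1 .$$ (ii) If $p_n=o(\sqrt n)$, then for every sequence of random vectors $\hat\beta_n^{(1)}$ that satisfies the last display (in particular for the estimator in (i)) and all $\alpha_n\in\mathbb R^{p_n}$ that are unit vectors for all large $n$, $$\alpha_n^{\mathsf T}F_n^{1/2}(\beta_{0n})(\hat\beta_n^{(1)}-\beta_{0n})\to_d N(0,1).$$ -/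

import Mathlib

open MeasureTheory ProbabilityTheory Filter Topology Asymptotics
open scoped Matrix RealInnerProductSpace

noncomputable section

/-- A univariate generalized linear model: responses with density
`c y * exp ((y θ - b θ) / φ)` with respect to a reference measure `ν` (Lebesgue, counting, ...),
where the canonical parameter `θ` ranges over the open interval `Θ`, and whose mean `b' θ` is tied
to the linear predictor `η ∈ D` by `b' θ = h η`, where `h` is the inverse of the strictly monotone
link function.  The open interval `D` is the range of admissible linear predictors (it is
`Set.univ` for most links); the values of `h` outside `D` and of `b` outside `Θ` are irrelevant. -/
structure GLM where
  ν : Measure ℝ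
  c : ℝ → ℝ
  φ : ℝ
  b : ℝ → ℝ
  Θ : Set ℝ
  h : ℝ → ℝ
  D : Set ℝ
  φ_pos : 0 < φ
  c_measurable : Measurable c
  c_nonneg : ∀ y, 0 ≤ c y
  Θ_open : IsOpen Θ
  Θ_interval : Θ.OrdConnected
  normalized : ∀ θ ∈ Θ, ∫⁻ y, ENNReal.ofReal (c y * Real.exp ((y * θ - b θ) / φ)) ∂ν = 1
  D_open : IsOpen D
  D_interval : D.OrdConnected
  h_measurable : Measurable h
  h_strictMono_or_strictAnti : StrictMonoOn h D ∨ StrictAntiOn h D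
  h_mapsTo : Set.MapsTo h D (deriv b '' Θ)
  /-- The variance `φ b'' θ` is positive at the parameters `θ` of the model. -/
  variance_pos : ∀ η ∈ D, 0 < φ * deriv (deriv b) (Function.invFunOn (deriv b) Θ (h η))

namespace GLM

variable (M : GLM)

/-- The law of a response with canonical parameter `θ`. -/
def law (θ : ℝ) : Measure ℝ :=
  M.ν.withDensity fun y => ENNReal.ofReal (M.c y * Real.exp ((y * θ - M.b θ) / M.φ))

/-- `u = μ⁻¹ ∘ h`, where `μ = b'` on `Θ`: the canonical parameter for the linear predictor `η`. -/
def u (η : ℝ) : ℝ := Function.invFunOn (deriv M.b) M.Θ (M.h η)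

/-- The variance `v η = φ b'' (u η)` of a response with linear predictor `η`. -/
def v (η : ℝ) : ℝ := M.φ * deriv (deriv M.b) (M.u η)

/-- `w = (h')² / v`. -/
def w (η : ℝ) : ℝ := (deriv M.h η) ^ 2 * (M.v η)⁻¹

/-- The score function: the gradient in `β` of the log-likelihood
`∑ i, ((y i * u (z iᵀ β) - b (u (z iᵀ β))) / φ + log (c (y i)))`. -/
def score {n p : ℕ} (z : Fin n → EuclideanSpace ℝ (Fin p)) (y : Fin n → ℝ)
    (β : EuclideanSpace ℝ (Fin p)) : EuclideanSpace ℝ (Fin p) :=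
  M.φ⁻¹ • ∑ i, (deriv M.u ⟪z i, β⟫ * (y i - M.h ⟪z i, β⟫)) • z i

/-- The Fisher information matrix `∑ i, w (z iᵀ β) z i z iᵀ`. -/
def fisher {n p : ℕ} (z : Fin n → EuclideanSpace ℝ (Fin p))
    (β : EuclideanSpace ℝ (Fin p)) : Matrix (Fin p) (Fin p) ℝ :=
  ∑ i, M.w ⟪z i, β⟫ • Matrix.vecMulVec (z i).ofLp (z i).ofLp

open scoped MatrixOrder in
/-- The (positive semidefinite) square root of the Fisher information matrix. -/
def sqrtFisher {n p : ℕ} (z : Fin n → EuclideanSpace ℝ (Fin p))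
    (β : EuclideanSpace ℝ (Fin p)) : Matrix (Fin p) (Fin p) ℝ :=
  CFC.sqrt (M.fisher z β)

/-- One step of Fisher scoring: `β + F(β)⁻¹ S(β)`. -/
def oneStep {n p : ℕ} (z : Fin n → EuclideanSpace ℝ (Fin p)) (y : Fin n → ℝ)
    (β : EuclideanSpace ℝ (Fin p)) : EuclideanSpace ℝ (Fin p) :=
  β + WithLp.toLp 2 ((M.fisher z β)⁻¹ *ᵥ (M.score z y β).ofLp)

/-- `β₁` solves the Fisher scoring equation started at `β`: `F(β) (β₁ - β) = S(β)`. -/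
def SolvesScoring {n p : ℕ} (z : Fin n → EuclideanSpace ℝ (Fin p)) (y : Fin n → ℝ)
    (β β₁ : EuclideanSpace ℝ (Fin p)) : Prop :=
  M.fisher z β *ᵥ (β₁ - β).ofLp = (M.score z y β).ofLp

/-- For every `n`, the `n` responses are independent, the `i`-th one having the law of the model
with linear predictor `z n iᵀ β₀ n`. -/
structure IsSample {p : ℕ → ℕ} (z : ∀ n, Fin n → EuclideanSpace ℝ (Fin (p n)))
    (β₀ : ∀ n, EuclideanSpace ℝ (Fin (p n))) {Ω : ℕ → Type*} [∀ n, MeasurableSpace (Ω n)]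
    (P : ∀ n, Measure (Ω n)) (y : ∀ n, Fin n → Ω n → ℝ) : Prop where
  measurable : ∀ n i, Measurable (y n i)
  indep : ∀ n, iIndepFun (y n) (P n)
  map_eq : ∀ n i, (P n).map (y n i) = M.law (M.u ⟪z n i, β₀ n⟫)

/-- The mean squared errors `E (e i ^ 2)`, `e i = y i - h (z iᵀ β₀)`, are bounded. -/
def BoundedErrorVariance {p : ℕ → ℕ} (z : ∀ n, Fin n → EuclideanSpace ℝ (Fin (p n)))
    (β₀ : ∀ n, EuclideanSpace ℝ (Fin (p n))) {Ω : ℕ → Type*} [∀ n, MeasurableSpace (Ω n)]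
    (P : ∀ n, Measure (Ω n)) (y : ∀ n, Fin n → Ω n → ℝ) : Prop :=
  ∃ C : ℝ, ∀ᶠ n in atTop, ∀ i : Fin n, ∫ ω, (y n i ω - M.h ⟪z n i, β₀ n⟫) ^ 2 ∂(P n) ≤ C

/-- The parameter spaces `B n` are compact and consist of admissible parameters, and the true
values are interior points, not too close to the boundary: `√(p n / n) = o(dist (β₀ n, (B n)ᶜ))`. -/
structure ParameterSpaces {p : ℕ → ℕ} (z : ∀ n, Fin n → EuclideanSpace ℝ (Fin (p n)))
    (β₀ : ∀ n, EuclideanSpace ℝ (Fin (p n)))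
    (B : ∀ n, Set (EuclideanSpace ℝ (Fin (p n)))) : Prop where
  compact : ∀ n, IsCompact (B n)
  interior : ∀ n, β₀ n ∈ interior (B n)
  admissible : ∀ n, ∀ i : Fin n, ∀ β ∈ B n, ⟪z n i, β⟫ ∈ M.D
  dist_boundary :
    (fun n : ℕ => √((p n : ℝ) / n)) =o[atTop] fun n => Metric.infDist (β₀ n) (B n)ᶜ

/-- `u` is three times and `w` once continuously differentiable; at the linear predictors `z iᵀ β`,
`β ∈ B n`, the model functions and their derivatives are bounded uniformly in `n` and `i`; and
`w (z iᵀ β₀)` is bounded away from zero. -/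
structure Regular {p : ℕ → ℕ} (z : ∀ n, Fin n → EuclideanSpace ℝ (Fin (p n)))
    (β₀ : ∀ n, EuclideanSpace ℝ (Fin (p n)))
    (B : ∀ n, Set (EuclideanSpace ℝ (Fin (p n)))) : Prop where
  u_contDiffOn : ContDiffOn ℝ 3 M.u M.D
  w_contDiffOn : ContDiffOn ℝ 1 M.w M.D
  bounded : ∃ C : ℝ, ∀ᶠ n in atTop, ∀ i : Fin n, ∀ β ∈ B n,
    |M.h ⟪z n i, β⟫| ≤ C ∧ |deriv M.h ⟪z n i, β⟫| ≤ C ∧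
    |deriv M.u ⟪z n i, β⟫| ≤ C ∧ |iteratedDeriv 2 M.u ⟪z n i, β⟫| ≤ C ∧
    |iteratedDeriv 3 M.u ⟪z n i, β⟫| ≤ C ∧
    |M.w ⟪z n i, β⟫| ≤ C ∧ |deriv M.w ⟪z n i, β⟫| ≤ C
  w_lower : ∃ W : ℝ, 0 < W ∧ ∀ᶠ n in atTop, ∀ i : Fin n, W ≤ M.w ⟪z n i, β₀ n⟫

end GLM

/-- All eigenvalues of `n⁻¹ ∑ i, z i z iᵀ` lie in a fixed interval `[Cmin, Cmax]`, `Cmin > 0`. -/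
def DesignEigenvalueBounds {p : ℕ → ℕ} (z : ∀ n, Fin n → EuclideanSpace ℝ (Fin (p n))) : Prop :=
  ∃ Cmin Cmax : ℝ, 0 < Cmin ∧ ∀ᶠ n : ℕ in atTop,
    spectrum ℝ ((n : ℝ)⁻¹ • ∑ i, Matrix.vecMulVec (z n i).ofLp (z n i).ofLp) ⊆ Set.Icc Cmin Cmax

/-- `max_i ‖z i‖² = O(p n)` and `sup_{‖α‖ = 1} ∑ i, |αᵀ z i|⁴ = O(n)`. -/
def DesignMomentBounds {p : ℕ → ℕ} (z : ∀ n, Fin n → EuclideanSpace ℝ (Fin (p n))) : Prop :=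
  (∃ C : ℝ, ∀ᶠ n in atTop, ∀ i : Fin n, ‖z n i‖ ^ 2 ≤ C * p n) ∧
  ∃ C : ℝ, ∀ᶠ n in atTop, ∀ α : EuclideanSpace ℝ (Fin (p n)), ‖α‖ = 1 →
    ∑ i, |⟪α, z n i⟫| ^ 4 ≤ C * n

/-- `√(n / p n)`-consistency: `‖βhat n - β₀ n‖ = O_P(√(p n / n))`. -/
def RootConsistent {p : ℕ → ℕ} (β₀ : ∀ n, EuclideanSpace ℝ (Fin (p n))) {Ω : ℕ → Type*}
    [∀ n, MeasurableSpace (Ω n)] (P : ∀ n, Measure (Ω n))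
    (βhat : ∀ n, Ω n → EuclideanSpace ℝ (Fin (p n))) : Prop :=
  ∀ ε : ℝ, 0 < ε → ∃ K : ℝ, ∀ᶠ n : ℕ in atTop,
    P n {ω | K * √((p n : ℝ) / n) < ‖βhat n ω - β₀ n‖} ≤ ENNReal.ofReal ε

end

/-! Write δ and x for the deviations of the initial and of the updated estimator from the true
parameter, r = √(p/n), e_i for the errors and d_i for the increment of h between the true and the
estimated linear predictor. The scoring equation is F(β₀ + δ)(x - δ) = φ⁻¹ ∑ u'(η̂_i)(e_i - d_i)
z_i. Since h = b' ∘ u on D, the identity u' h' = φ w holds there, so u'(η̂_i) d_i equals φ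
w(η̂_i)⟨z_i, δ⟩ up to a quadratic remainder. The terms linear in δ that carry no error e_i therefore
cancel, and F(β₀ + δ) x is the score at β₀ plus small terms.

These estimates are deterministic. The fourth-moment bound on the design controls sums such as ∑
|⟨z_i, δ⟩² ⟨z_i, g⟩| through Cauchy-Schwarz, and F(β₀ + δ) has order at least n because w is
Lipschitz near β₀ (`le_sum_mul_inner_sq`); this lower bound already gives invertibility in part (i).
Pairing the equation with x yields ‖x‖ = O(r) (`norm_scoring_step_le`). Pairing it with a vector g
of length O(n^(-1/2)) yields g · F(β₀) x = g · S(β₀) + O(√n r²) (`abs_scoring_linearization_le`),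
and √n r² = p/√n tends to 0 in part (ii). The estimator may depend on the responses in any way:
wherever it meets the errors, it is separated from them by Cauchy-Schwarz, and only error terms free
of it need probabilistic bounds, by second moments (`exists_eventually_error_tails`).

With g = F(β₀)^(-1/2) α the left side is the statistic of interest and g · S(β₀) has variance one.
Its normal limit comes from moment generating functions (`tendstoInDistribution_score`): for an
exponential family the logarithm of the generating function of each summand is an increment of b
minus its linear part. A second-order expansion of b with a small remainder needs v to be Lipschitz
near the true predictor. This follows from w = (u'/φ)² v: as w is bounded below and v above, u'
stays away from zero, so v inherits the regularity of w and u' (`abs_v_sub_le`). Since max |⟨z_i,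
g⟩| = O(r), the remainders add up to O(r). Curtiss' and Slutsky's theorems conclude. -/

namespace GLM

variable (M : GLM)

/-! ### Exponential families: generating function, mean and variance of a response -/

lemma measurable_density (θ : ℝ) :
    Measurable fun y => ENNReal.ofReal (M.c y * Real.exp ((y * θ - M.b θ) / M.φ)) := by
  have := M.c_measurable
  fun_prop

lemma isProbabilityMeasure_law {θ : ℝ} (hθ : θ ∈ M.Θ) : IsProbabilityMeasure (M.law θ) :=
  ⟨by rw [law, withDensity_apply _ MeasurableSet.univ, Measure.restrict_univ, M.normalized θ hθ]⟩

/-- Tilting by exp(s y) moves the canonical parameter from θ to θ + φ s, and the tilted density is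
normalized by assumption. -/
lemma lintegral_exp_mul_law {θ s : ℝ} (hs : θ + M.φ * s ∈ M.Θ) :
    ∫⁻ y, ENNReal.ofReal (Real.exp (s * y)) ∂(M.law θ)
      = ENNReal.ofReal (Real.exp ((M.b (θ + M.φ * s) - M.b θ) / M.φ)) := by
  rw [law, lintegral_withDensity_eq_lintegral_mul _ (M.measurable_density θ) (by fun_prop)]
  calc _ = ∫⁻ y, ENNReal.ofReal (Real.exp ((M.b (θ + M.φ * s) - M.b θ) / M.φ)) *
        ENNReal.ofReal (M.c y * Real.exp ((y * (θ + M.φ * s) - M.b (θ + M.φ * s)) / M.φ)) ∂M.ν := by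
        refine lintegral_congr fun y => ?_
        simp only [Pi.mul_apply]
        rw [← ENNReal.ofReal_mul (mul_nonneg (M.c_nonneg y) (Real.exp_nonneg _)),
          ← ENNReal.ofReal_mul (Real.exp_nonneg _), mul_assoc, ← Real.exp_add, mul_left_comm,
          ← Real.exp_add]
        congr 3
        field_simp [M.φ_pos.ne']
        ring
    _ = _ := by
        rw [lintegral_const_mul _ (M.measurable_density _), M.normalized _ hs, mul_one]

lemma integrable_exp_mul_law {θ s : ℝ} (hs : θ + M.φ * s ∈ M.Θ) :
    Integrable (fun y => Real.exp (s * y)) (M.law θ) := by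
  refine ⟨by fun_prop, ?_⟩
  rw [hasFiniteIntegral_iff_ofReal (ae_of_all _ fun y => Real.exp_nonneg _),
    M.lintegral_exp_mul_law hs]
  exact ENNReal.ofReal_lt_top

lemma mgf_law {θ s : ℝ} (hs : θ + M.φ * s ∈ M.Θ) :
    mgf id (M.law θ) s = Real.exp ((M.b (θ + M.φ * s) - M.b θ) / M.φ) := by
  simp only [mgf, id]
  rw [integral_eq_lintegral_of_nonneg_ae (ae_of_all _ fun y => Real.exp_nonneg _) (by fun_prop),
    M.lintegral_exp_mul_law hs, ENNReal.toReal_ofReal (Real.exp_nonneg _)]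

lemma eventually_add_mul_mem {θ : ℝ} (hθ : θ ∈ M.Θ) : ∀ᶠ s in 𝓝 (0 : ℝ), θ + M.φ * s ∈ M.Θ := by
  have : ContinuousAt (fun s : ℝ => θ + M.φ * s) 0 := by fun_prop
  exact this.eventually_mem (M.Θ_open.mem_nhds (by simpa using hθ))

lemma zero_mem_interior_integrableExpSet {θ : ℝ} (hθ : θ ∈ M.Θ) :
    (0 : ℝ) ∈ interior (integrableExpSet id (M.law θ)) := by
  rw [mem_interior_iff_mem_nhds]
  filter_upwards [M.eventually_add_mul_mem hθ] with s hs
  exact M.integrable_exp_mul_law hs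

/-- No smoothness of b is part of the model. It comes from this identity, since a cumulant
generating function is analytic in the interior of its domain. -/
lemma eventually_b_eq {θ : ℝ} (hθ : θ ∈ M.Θ) :
    M.b =ᶠ[𝓝 θ] fun ϑ => M.b θ + M.φ * cgf id (M.law θ) ((ϑ - θ) / M.φ) := by
  filter_upwards [M.Θ_open.mem_nhds hθ] with ϑ hϑ
  have e : θ + M.φ * ((ϑ - θ) / M.φ) = ϑ := by field_simp [M.φ_pos.ne']; ring
  rw [cgf, M.mgf_law (by rwa [e]), e, Real.log_exp]
  field_simp [M.φ_pos.ne']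
  ring

lemma analyticAt_b {θ : ℝ} (hθ : θ ∈ M.Θ) : AnalyticAt ℝ M.b θ := by
  rw [analyticAt_congr (M.eventually_b_eq hθ)]
  have h0 : AnalyticAt ℝ (cgf id (M.law θ)) ((θ - θ) / M.φ) := by
    have := analyticAt_cgf (M.zero_mem_interior_integrableExpSet hθ)
    simpa using this
  have h1 : AnalyticAt ℝ (fun ϑ : ℝ => (ϑ - θ) / M.φ) θ := by fun_prop
  have h2 := AnalyticAt.comp (f := fun ϑ : ℝ => (ϑ - θ) / M.φ) h0 h1
  exact analyticAt_const.add (analyticAt_const.mul h2)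

lemma deriv_b_eventuallyEq {θ : ℝ} (hθ : θ ∈ M.Θ) :
    deriv M.b =ᶠ[𝓝 θ] fun ϑ => deriv (cgf id (M.law θ)) ((ϑ - θ) / M.φ) := by
  have hA : ∀ᶠ ϑ in 𝓝 θ, AnalyticAt ℝ (cgf id (M.law θ)) ((ϑ - θ) / M.φ) := by
    have := (analyticAt_cgf (M.zero_mem_interior_integrableExpSet hθ)).eventually_analyticAt
    have hc : ContinuousAt (fun ϑ : ℝ => (ϑ - θ) / M.φ) θ := by fun_prop
    exact hc.eventually (by simpa using this)
  filter_upwards [(M.eventually_b_eq hθ).eventually_nhds, hA] with ϑ h1 h2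
  rw [Filter.EventuallyEq.deriv_eq h1]
  have h3 : HasDerivAt (fun ϑ : ℝ => (ϑ - θ) / M.φ) (1 / M.φ) ϑ :=
    ((hasDerivAt_id ϑ).sub_const θ).div_const _
  have h4 := ((h2.differentiableAt.hasDerivAt.comp ϑ h3).const_mul M.φ).const_add (M.b θ)
  refine h4.deriv.trans ?_
  field_simp [M.φ_pos.ne']

lemma integral_id_law {θ : ℝ} (hθ : θ ∈ M.Θ) : ∫ y, y ∂(M.law θ) = deriv M.b θ := by
  have := M.isProbabilityMeasure_law hθ
  rw [(M.deriv_b_eventuallyEq hθ).eq_of_nhds]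
  simp [deriv_cgf_zero (M.zero_mem_interior_integrableExpSet hθ)]

lemma variance_law {θ : ℝ} (hθ : θ ∈ M.Θ) :
    Var[id; M.law θ] = M.φ * deriv (deriv M.b) θ := by
  have := M.isProbabilityMeasure_law hθ
  have h0 := M.zero_mem_interior_integrableExpSet hθ
  have hv := variance_tilted_mul h0
  simp only [zero_mul, tilted_const] at hv
  rw [hv, (M.deriv_b_eventuallyEq hθ).deriv_eq]
  have hA := (analyticAt_cgf h0).deriv
  have h3 : HasDerivAt (fun ϑ : ℝ => (ϑ - θ) / M.φ) (1 / M.φ) θ :=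
    ((hasDerivAt_id θ).sub_const θ).div_const _
  have h4 : HasDerivAt (deriv (cgf id (M.law θ))) (deriv (deriv (cgf id (M.law θ))) 0)
      ((θ - θ) / M.φ) := by
    simpa using hA.differentiableAt.hasDerivAt
  have h5 := (h4.comp θ h3).deriv
  rw [Function.comp_def] at h5
  rw [h5, iteratedDeriv_succ, iteratedDeriv_one]
  field_simp [M.φ_pos.ne']

lemma memLp_id_law {θ : ℝ} (hθ : θ ∈ M.Θ) : MemLp id 2 (M.law θ) := by
  have := M.isProbabilityMeasure_law hθ
  exact memLp_of_mem_interior_integrableExpSet (M.zero_mem_interior_integrableExpSet hθ) 2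

/-- The exponential factor never vanishes, so whether a set is null depends only on where c
vanishes, not on the parameter. -/
lemma law_absolutelyContinuous (θ θ' : ℝ) : M.law θ ≪ M.law θ' := by
  refine Measure.AbsolutelyContinuous.mk fun s hs h => ?_
  have hz : ∀ t : ℝ, M.law t s = 0 ↔ ∀ᵐ y ∂(M.ν.restrict s), M.c y = 0 := by
    intro t
    rw [law, withDensity_apply _ hs, lintegral_eq_zero_iff (M.measurable_density t)]
    refine eventually_congr (ae_of_all _ fun y => ?_)
    simp only [Pi.zero_apply, ENNReal.ofReal_eq_zero]
    constructor
    · intro h1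
      refine le_antisymm ?_ (M.c_nonneg y)
      by_contra! h2
      exact absurd h1 (not_le.2 (mul_pos h2 (Real.exp_pos _)))
    · intro h1; simp [h1]
  rw [hz] at h ⊢
  exact h

lemma u_mem {η : ℝ} (hη : η ∈ M.D) : M.u η ∈ M.Θ :=
  Function.invFunOn_mem (M.h_mapsTo hη)

lemma deriv_b_u {η : ℝ} (hη : η ∈ M.D) : deriv M.b (M.u η) = M.h η :=
  Function.invFunOn_eq (M.h_mapsTo hη)

lemma v_pos {η : ℝ} (hη : η ∈ M.D) : 0 < M.v η := M.variance_pos η hη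

/-- Positivity of the variance is assumed only at parameters reached from D. A zero variance at
another θ would make that law a point mass, hence every law of the family, by mutual absolute
continuity. The conclusion on all of Θ makes b' injective there, so that its inverse is measurable.
-/
lemma deriv_deriv_b_pos (hD : M.D.Nonempty) {θ : ℝ} (hθ : θ ∈ M.Θ) :
    0 < deriv (deriv M.b) θ := by
  obtain ⟨η, hη⟩ := hD
  have := M.isProbabilityMeasure_law hθ
  have := M.isProbabilityMeasure_law (M.u_mem hη)
  have h1 : 0 < Var[id; M.law (M.u η)] := by
    rw [M.variance_law (M.u_mem hη)]; exact M.v_pos hη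
  by_contra! h
  have h2 : Var[id; M.law θ] = 0 := by
    refine le_antisymm ?_ (variance_nonneg _ _)
    rw [M.variance_law hθ]
    exact mul_nonpos_of_nonneg_of_nonpos M.φ_pos.le h
  have h3 : id =ᵐ[M.law θ] fun _ => (M.law θ)[id] := by
    have h4 : eVar[id; M.law θ] = 0 := by
      rw [← (M.memLp_id_law hθ).ofReal_variance_eq, h2, ENNReal.ofReal_zero]
    exact (evariance_eq_zero_iff (by fun_prop)).1 h4
  have h5 := (M.law_absolutelyContinuous (M.u η) θ).ae_eq h3
  rw [variance_congr h5, variance_eq_integral (by fun_prop)] at h1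
  simp at h1

lemma strictMonoOn_deriv_b (hD : M.D.Nonempty) : StrictMonoOn (deriv M.b) M.Θ := by
  refine strictMonoOn_of_deriv_pos M.Θ_interval.convex ?_ ?_
  · exact fun θ hθ => (M.analyticAt_b hθ).deriv.continuousAt.continuousWithinAt
  · intro θ hθ
    rw [M.Θ_open.interior_eq] at hθ
    exact M.deriv_deriv_b_pos hD hθ

end GLM

/-! ### Measurability of the model functions and of the one-step estimator -/

/-- The inverse of a continuous strictly monotone function on an interval is measurable. -/
lemma measurable_invFunOn_of_strictMonoOn {f : ℝ → ℝ} {s : Set ℝ} (hs : s.OrdConnected)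
    (hc : ContinuousOn f s) (hf : StrictMonoOn f s) : Measurable (Function.invFunOn f s) := by
  have hI : (f '' s).OrdConnected := (hs.isPreconnected.image f hc).ordConnected
  refine measurable_of_Ioi fun a => ?_
  -- By monotonicity the preimage of (a, ∞) inside the image of f is the image of an interval, hence
  -- an interval. Off the image, `Function.invFunOn` takes one fixed default value, so the
  -- complement is included entirely or not at all.
  have key : Function.invFunOn f s ⁻¹' Set.Ioi a
      = (f '' (s ∩ Set.Ioi a)) ∪
        ((f '' s)ᶜ ∩ {_x | a < Classical.choice (⟨0⟩ : Nonempty ℝ)}) := by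
    ext x
    by_cases hx : x ∈ f '' s
    · obtain ⟨t, ht, rfl⟩ := hx
      have h1 := hf.injOn.leftInvOn_invFunOn ht
      have h2 : f t ∈ f '' s := ⟨t, ht, rfl⟩
      simp only [Set.mem_preimage, Set.mem_union, h1, Set.mem_inter_iff, Set.mem_compl_iff, h2,
        not_true_eq_false, false_and, or_false]
      constructor
      · exact fun h => ⟨t, ⟨ht, h⟩, rfl⟩
      · rintro ⟨t', ⟨h3, h4⟩, h5⟩
        rwa [← hf.injOn h3 ht h5]
    · have h1 : Function.invFunOn f s x = Classical.choice (⟨0⟩ : Nonempty ℝ) :=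
        Function.invFunOn_neg hx
      have h2 : x ∉ f '' (s ∩ Set.Ioi a) := fun h => hx (Set.image_mono Set.inter_subset_left h)
      simp [h1, h2, hx, -Set.mem_image]
  rw [key]
  refine MeasurableSet.union ?_ (hI.measurableSet.compl.inter (MeasurableSet.const _))
  have : (s ∩ Set.Ioi a).OrdConnected := hs.inter Set.ordConnected_Ioi
  exact ((this.isPreconnected.image f (hc.mono Set.inter_subset_left)).ordConnected).measurableSet

namespace GLM

variable (M : GLM)

lemma measurable_u (hD : M.D.Nonempty) : Measurable M.u :=
  (measurable_invFunOn_of_strictMonoOn M.Θ_interval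
    (fun _ hθ => (M.analyticAt_b hθ).deriv.continuousAt.continuousWithinAt)
    (M.strictMonoOn_deriv_b hD)).comp M.h_measurable

lemma measurable_w (hD : M.D.Nonempty) : Measurable M.w := by
  have h1 := M.measurable_u hD
  have h2 : Measurable (deriv M.h) := measurable_deriv _
  have h3 : Measurable (deriv (deriv M.b)) := measurable_deriv _
  unfold w v
  exact (h2.pow_const 2).mul ((h3.comp h1).const_mul _).inv

lemma measurable_score {n p : ℕ} (z : Fin n → EuclideanSpace ℝ (Fin p)) :
    Measurable fun x : (Fin n → ℝ) × EuclideanSpace ℝ (Fin p) => M.score z x.1 x.2 := by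
  have h1 : Measurable (deriv M.u) := measurable_deriv _
  have h2 := M.h_measurable
  unfold score
  fun_prop

lemma measurable_fisher_apply (hD : M.D.Nonempty) {n p : ℕ}
    (z : Fin n → EuclideanSpace ℝ (Fin p)) (j k : Fin p) :
    Measurable fun β => M.fisher z β j k := by
  have h1 := M.measurable_w hD
  simp only [fisher, Matrix.sum_apply, Matrix.smul_apply, smul_eq_mul]
  fun_prop

end GLM

/-- The adjugate formula covers singular matrices too: there the inverse of the determinant is 0.
This supplies the measurable convention for the one-step estimator. -/
lemma measurable_matrix_inv_apply {p : ℕ} (j k : Fin p) :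
    Measurable fun A : Fin p → Fin p → ℝ => (Matrix.of A)⁻¹ j k := by
  simp only [Matrix.inv_def, Matrix.smul_apply, smul_eq_mul, Ring.inverse_eq_inv']
  have hc : Continuous fun A : Fin p → Fin p → ℝ => Matrix.of A := continuous_id
  exact (Continuous.matrix_det hc).measurable.inv.mul
    ((Continuous.matrix_adjugate hc).matrix_elem j k).measurable

namespace GLM

variable (M : GLM)

lemma measurable_oneStep (hD : M.D.Nonempty) {n p : ℕ} (z : Fin n → EuclideanSpace ℝ (Fin p)) :
    Measurable fun x : (Fin n → ℝ) × EuclideanSpace ℝ (Fin p) => M.oneStep z x.1 x.2 := by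
  unfold oneStep
  refine measurable_snd.add ((WithLp.measurable_toLp 2 _).comp (measurable_pi_lambda _ fun j => ?_))
  simp only [Matrix.mulVec, dotProduct]
  refine Finset.measurable_fun_sum _ fun k _ => Measurable.mul ?_ ?_
  · have h1 : Measurable fun x : (Fin n → ℝ) × EuclideanSpace ℝ (Fin p) =>
        (fun j k => M.fisher z x.2 j k : Fin p → Fin p → ℝ) :=
      measurable_pi_lambda _ fun j => measurable_pi_lambda _ fun k =>
        (M.measurable_fisher_apply hD z j k).comp measurable_snd
    exact (measurable_matrix_inv_apply j k).comp h1
  · exact (measurable_pi_apply k).comp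
      ((WithLp.measurable_ofLp 2 _).comp (M.measurable_score z))

end GLM

/-! ### Deterministic estimates for a scoring step -/

/-- The Cauchy-Schwarz inequality for finite sums, with bounds for the two factors. -/
lemma sum_abs_mul_le_of_sum_sq_le {ι : Type*} [Fintype ι] {f g : ι → ℝ} {a b : ℝ} (ha : 0 ≤ a)
    (hb : 0 ≤ b) (hf : ∑ i, f i ^ 2 ≤ a ^ 2) (hg : ∑ i, g i ^ 2 ≤ b ^ 2) :
    ∑ i, |f i * g i| ≤ a * b := by
  have h := Finset.sum_mul_sq_le_sq_mul_sq Finset.univ (fun i => |f i|) (fun i => |g i|)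
  simp only [sq_abs] at h
  simp only [abs_mul]
  refine abs_le_of_sq_le_sq' ?_ (mul_nonneg ha hb) |>.2
  rw [mul_pow]
  exact h.trans (mul_le_mul hf hg (Finset.sum_nonneg fun i _ => sq_nonneg _) (sq_nonneg _))

section Design

variable {E : Type*} [NormedAddCommGroup E] [InnerProductSpace ℝ E] {ι : Type*} [Fintype ι]

/-- Polarized form of the fourth-moment bound, by Cauchy-Schwarz on the squares. It handles every
product of two linear predictors below. -/
lemma sum_inner_sq_mul_inner_sq_le {z : ι → E} {A s : ℝ}
    (h4 : ∀ a, ∑ i, ⟪z i, a⟫ ^ 4 ≤ (A * s * ‖a‖ ^ 2) ^ 2) (hA : 0 ≤ A) (hs : 0 ≤ s) (a b : E) :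
    ∑ i, (⟪z i, a⟫ * ⟪z i, b⟫) ^ 2 ≤ (A * s * ‖a‖ * ‖b‖) ^ 2 := by
  have h := sum_abs_mul_le_of_sum_sq_le (f := fun i => ⟪z i, a⟫ ^ 2) (g := fun i => ⟪z i, b⟫ ^ 2)
    (a := A * s * ‖a‖ ^ 2) (b := A * s * ‖b‖ ^ 2) (by positivity) (by positivity)
    (by simpa only [← pow_mul] using h4 a) (by simpa only [← pow_mul] using h4 b)
  refine le_trans (le_of_eq ?_) (h.trans (le_of_eq (by ring)))
  refine Finset.sum_congr rfl fun i _ => ?_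
  rw [abs_of_nonneg (by positivity)]; ring

/-- A quadratic form `∑ w i ⟪z i, x⟫²` stays bounded below when the weights are perturbed by
`O(|⟪z i, δ⟫|)` with a small `δ`. -/
lemma le_sum_mul_inner_sq {z : ι → E} {w w' : ι → ℝ} {δ : E} {c A L W s : ℝ} (hA : 0 ≤ A)
    (hL : 0 ≤ L) (hW : 0 < W) (hs : 0 < s)
    (hlo : ∀ a, c * s ^ 2 * ‖a‖ ^ 2 ≤ ∑ i, ⟪z i, a⟫ ^ 2)
    (hhi : ∀ a, ∑ i, ⟪z i, a⟫ ^ 2 ≤ (A * s * ‖a‖) ^ 2)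
    (h4 : ∀ a, ∑ i, ⟪z i, a⟫ ^ 4 ≤ (A * s * ‖a‖ ^ 2) ^ 2)
    (hw : ∀ i, |w' i - w i| ≤ L * |⟪z i, δ⟫|) (hwW : ∀ i, W ≤ w i)
    (hsmall : L * A ^ 2 * ‖δ‖ ≤ c * W / 2) (x : E) :
    c * W / 2 * s ^ 2 * ‖x‖ ^ 2 ≤ ∑ i, w' i * ⟪z i, x⟫ ^ 2 := by
  have h1 : ∑ i, |(⟪z i, δ⟫ * ⟪z i, x⟫) * ⟪z i, x⟫| ≤
      (A * s * ‖δ‖ * ‖x‖) * (A * s * ‖x‖) :=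
    sum_abs_mul_le_of_sum_sq_le (by positivity) (by positivity)
      (sum_inner_sq_mul_inner_sq_le h4 hA hs.le δ x) (hhi x)
  have h2 : W * ∑ i, ⟪z i, x⟫ ^ 2 - L * ∑ i, |(⟪z i, δ⟫ * ⟪z i, x⟫) * ⟪z i, x⟫| ≤
      ∑ i, w' i * ⟪z i, x⟫ ^ 2 := by
    rw [Finset.mul_sum, Finset.mul_sum, ← Finset.sum_sub_distrib]
    refine Finset.sum_le_sum fun i _ => ?_
    have h3 := (abs_le.1 (hw i)).1
    have h5 := hwW i
    have h6 : |(⟪z i, δ⟫ * ⟪z i, x⟫) * ⟪z i, x⟫| = |⟪z i, δ⟫| * ⟪z i, x⟫ ^ 2 := by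
      rw [mul_assoc, abs_mul, ← sq, abs_of_nonneg (sq_nonneg ⟪z i, x⟫)]
    rw [h6]
    nlinarith [sq_nonneg ⟪z i, x⟫]
  have h7 : L * ∑ i, |(⟪z i, δ⟫ * ⟪z i, x⟫) * ⟪z i, x⟫| ≤ c * W / 2 * s ^ 2 * ‖x‖ ^ 2 := by
    calc _ ≤ L * ((A * s * ‖δ‖ * ‖x‖) * (A * s * ‖x‖)) := mul_le_mul_of_nonneg_left h1 hL
      _ = (L * A ^ 2 * ‖δ‖) * (s ^ 2 * ‖x‖ ^ 2) := by ring
      _ ≤ (c * W / 2) * (s ^ 2 * ‖x‖ ^ 2) := by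
          exact mul_le_mul_of_nonneg_right hsmall (by positivity)
      _ = _ := by ring
  have h8 := mul_le_mul_of_nonneg_left (hlo x) hW.le
  nlinarith

/-- Rate of convergence of a Fisher scoring step. -/
lemma norm_scoring_step_le {z : ι → E} {w w' u₁ u₁' e d : ι → ℝ} {δ x : E}
    {c A L W K s r φ : ℝ} (hφ : 0 < φ) (hc : 0 < c) (hA : 0 ≤ A) (hL : 0 ≤ L) (hW : 0 < W)
    (hK : 0 ≤ K) (hs : 0 < s) (hr : 0 ≤ r) (hr1 : r ≤ 1)
    (hlo : ∀ a, c * s ^ 2 * ‖a‖ ^ 2 ≤ ∑ i, ⟪z i, a⟫ ^ 2)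
    (hhi : ∀ a, ∑ i, ⟪z i, a⟫ ^ 2 ≤ (A * s * ‖a‖) ^ 2)
    (h4 : ∀ a, ∑ i, ⟪z i, a⟫ ^ 4 ≤ (A * s * ‖a‖ ^ 2) ^ 2)
    (hw : ∀ i, |w' i - w i| ≤ L * |⟪z i, δ⟫|) (hwW : ∀ i, W ≤ w i)
    (hu : ∀ i, |u₁' i - u₁ i| ≤ L * |⟪z i, δ⟫|)
    (hd : ∀ i, |u₁' i * d i - φ * w' i * ⟪z i, δ⟫| ≤ L * ⟪z i, δ⟫ ^ 2)
    (heq : ∑ i, (w' i * ⟪z i, x - δ⟫) • z i = φ⁻¹ • ∑ i, (u₁' i * (e i - d i)) • z i)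
    (hδ : ‖δ‖ ≤ K * r) (hS : ‖∑ i, (u₁ i * e i) • z i‖ ≤ K * s ^ 2 * r)
    (he : ∑ i, e i ^ 2 ≤ (K * s) ^ 2) (hsmall : L * A ^ 2 * (K * r) ≤ c * W / 2) :
    ‖x‖ ≤ 2 / (c * W) * φ⁻¹ * (K + L * A * K ^ 2 + L * A ^ 2 * K ^ 2) * r := by
  rcases eq_or_ne x 0 with rfl | hx0
  · rw [norm_zero]; positivity
  have hx : 0 < ‖x‖ := norm_pos_iff.2 hx0
  have hδ0 := norm_nonneg δ
  have e1 := congrArg (fun y => ⟪y, x⟫) heq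
  simp only [sum_inner, inner_smul_left, RCLike.conj_to_real, inner_sub_right] at e1
  -- The scoring equation paired with x. The part φ w' ⟨z, δ⟩ of u₁' d cancels the δ on the left,
  -- leaving the score at the true parameter and two remainders.
  have e2 : ∑ i, w' i * ⟪z i, x⟫ ^ 2 = φ⁻¹ * (⟪∑ i, (u₁ i * e i) • z i, x⟫
      + ∑ i, (u₁' i - u₁ i) * ⟪z i, x⟫ * e i
      - ∑ i, (u₁' i * d i - φ * w' i * ⟪z i, δ⟫) * ⟪z i, x⟫) := by
    have e3 : ∑ i, w' i * ⟪z i, x⟫ ^ 2 = ∑ i, w' i * (⟪z i, x⟫ - ⟪z i, δ⟫) * ⟪z i, x⟫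
        + φ⁻¹ * ∑ i, φ * w' i * ⟪z i, δ⟫ * ⟪z i, x⟫ := by
      rw [Finset.mul_sum, ← Finset.sum_add_distrib]
      refine Finset.sum_congr rfl fun i _ => ?_
      field_simp
      ring
    rw [e3, e1, ← mul_add, ← Finset.sum_add_distrib]
    congr 1
    simp only [sum_inner, inner_smul_left, RCLike.conj_to_real]
    rw [← Finset.sum_add_distrib, ← Finset.sum_sub_distrib]
    refine Finset.sum_congr rfl fun i _ => ?_
    ring
  have b0 : c * W / 2 * s ^ 2 * ‖x‖ ^ 2 ≤ ∑ i, w' i * ⟪z i, x⟫ ^ 2 :=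
    le_sum_mul_inner_sq hA hL hW hs hlo hhi h4 hw hwW
      ((mul_le_mul_of_nonneg_left hδ (by positivity)).trans hsmall) x
  have b1 : ⟪∑ i, (u₁ i * e i) • z i, x⟫ ≤ K * s ^ 2 * r * ‖x‖ :=
    (real_inner_le_norm _ _).trans (mul_le_mul_of_nonneg_right hS hx.le)
  have b2 : ∑ i, (u₁' i - u₁ i) * ⟪z i, x⟫ * e i ≤ L * ((A * s * ‖δ‖ * ‖x‖) * (K * s)) := by
    have h1 : ∑ i, |(⟪z i, δ⟫ * ⟪z i, x⟫) * e i| ≤ (A * s * ‖δ‖ * ‖x‖) * (K * s) :=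
      sum_abs_mul_le_of_sum_sq_le (by positivity) (by positivity)
        (sum_inner_sq_mul_inner_sq_le h4 hA hs.le δ x) he
    refine le_trans ?_ (mul_le_mul_of_nonneg_left h1 hL)
    rw [Finset.mul_sum]
    refine Finset.sum_le_sum fun i _ => (le_abs_self _).trans ?_
    rw [abs_mul, abs_mul, abs_mul, abs_mul]
    calc _ ≤ (L * |⟪z i, δ⟫|) * |⟪z i, x⟫| * |e i| := by gcongr; exact hu i
      _ = _ := by ring
  have b3 : -∑ i, (u₁' i * d i - φ * w' i * ⟪z i, δ⟫) * ⟪z i, x⟫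
      ≤ L * ((A * s * ‖δ‖ ^ 2) * (A * s * ‖x‖)) := by
    have h1 : ∑ i, |⟪z i, δ⟫ ^ 2 * ⟪z i, x⟫| ≤ (A * s * ‖δ‖ ^ 2) * (A * s * ‖x‖) :=
      sum_abs_mul_le_of_sum_sq_le (by positivity) (by positivity)
        (by simpa only [← pow_mul] using h4 δ) (hhi x)
    refine le_trans ?_ (mul_le_mul_of_nonneg_left h1 hL)
    rw [Finset.mul_sum, ← Finset.sum_neg_distrib]
    refine Finset.sum_le_sum fun i _ => (neg_le_abs _).trans ?_
    rw [abs_mul, abs_mul, abs_of_nonneg (sq_nonneg ⟪z i, δ⟫)]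
    calc _ ≤ (L * ⟪z i, δ⟫ ^ 2) * |⟪z i, x⟫| := by gcongr; exact hd i
      _ = _ := by ring
  have b4 : L * ((A * s * ‖δ‖ * ‖x‖) * (K * s)) ≤ L * A * K ^ 2 * s ^ 2 * r * ‖x‖ := by
    calc _ = (L * A * K * s ^ 2 * ‖x‖) * ‖δ‖ := by ring
      _ ≤ (L * A * K * s ^ 2 * ‖x‖) * (K * r) := by gcongr
      _ = _ := by ring
  -- The remainder is quadratic in r. One factor r is given up through r ≤ 1, as only a bound of
  -- first order is needed.
  have b5 : L * ((A * s * ‖δ‖ ^ 2) * (A * s * ‖x‖)) ≤ L * A ^ 2 * K ^ 2 * s ^ 2 * r * ‖x‖ := by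
    calc _ = (L * A ^ 2 * s ^ 2 * ‖x‖) * ‖δ‖ ^ 2 := by ring
      _ ≤ (L * A ^ 2 * s ^ 2 * ‖x‖) * (K * r) ^ 2 := by gcongr
      _ = (L * A ^ 2 * s ^ 2 * ‖x‖ * K ^ 2 * r) * r := by ring
      _ ≤ (L * A ^ 2 * s ^ 2 * ‖x‖ * K ^ 2 * r) * 1 := by gcongr
      _ = _ := by ring
  have b6 : c * W / 2 * s ^ 2 * ‖x‖ ^ 2 ≤
      φ⁻¹ * ((K + L * A * K ^ 2 + L * A ^ 2 * K ^ 2) * s ^ 2 * r * ‖x‖) := by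
    rw [e2] at b0
    refine b0.trans (mul_le_mul_of_nonneg_left ?_ (by positivity))
    linarith
  have hp : 0 < s ^ 2 * ‖x‖ := by positivity
  refine le_of_mul_le_mul_left ?_ hp
  calc s ^ 2 * ‖x‖ * ‖x‖ = 2 / (c * W) * (c * W / 2 * s ^ 2 * ‖x‖ ^ 2) := by field_simp
    _ ≤ 2 / (c * W) * (φ⁻¹ * ((K + L * A * K ^ 2 + L * A ^ 2 * K ^ 2) * s ^ 2 * r * ‖x‖)) :=
        mul_le_mul_of_nonneg_left b6 (by positivity)
    _ = _ := by ring

/-- The linearization error of a Fisher scoring step in a fixed direction. -/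
lemma abs_scoring_linearization_le {z : ι → E} {w w' u₁ u₁' u₂ e d : ι → ℝ} {δ x g : E}
    {A L K K₁ s r φ : ℝ} (hφ : 0 < φ) (hA : 0 ≤ A) (hL : 0 ≤ L)
    (hK : 0 ≤ K) (_ : 0 ≤ K₁) (hs : 0 < s) (hr : 0 ≤ r)
    (hhi : ∀ a, ∑ i, ⟪z i, a⟫ ^ 2 ≤ (A * s * ‖a‖) ^ 2)
    (h4 : ∀ a, ∑ i, ⟪z i, a⟫ ^ 4 ≤ (A * s * ‖a‖ ^ 2) ^ 2)
    (hw : ∀ i, |w' i - w i| ≤ L * |⟪z i, δ⟫|)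
    (hu : ∀ i, |u₁' i - u₁ i - u₂ i * ⟪z i, δ⟫| ≤ L * ⟪z i, δ⟫ ^ 2)
    (hd : ∀ i, |u₁' i * d i - φ * w' i * ⟪z i, δ⟫| ≤ L * ⟪z i, δ⟫ ^ 2)
    (heq : ∑ i, (w' i * ⟪z i, x - δ⟫) • z i = φ⁻¹ • ∑ i, (u₁' i * (e i - d i)) • z i)
    (hδ : ‖δ‖ ≤ K * r) (hx : ‖x‖ ≤ K₁ * r) (hg : s * ‖g‖ ≤ K)
    (hG : ‖∑ i, (u₂ i * ⟪z i, g⟫ * e i) • z i‖ ≤ K * s * r)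
    (hge : ∑ i, (⟪z i, g⟫ * e i) ^ 2 ≤ K ^ 2) :
    |∑ i, w i * ⟪z i, g⟫ * ⟪z i, x⟫ - φ⁻¹ * ∑ i, u₁ i * ⟪z i, g⟫ * e i| ≤
      (L * A ^ 2 * K ^ 2 * K₁ + φ⁻¹ * (K ^ 2 + L * A * K ^ 3 + L * A ^ 2 * K ^ 3))
        * (s * r ^ 2) := by
  have e1 := congrArg (fun y => ⟪y, g⟫) heq
  simp only [sum_inner, inner_smul_left, RCLike.conj_to_real, inner_sub_right] at e1
  -- The same cancellation, now paired with g and with the weights at the true parameter on the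
  -- left. Changing the weights costs the first sum. The change of u₁' is split into its linear
  -- part, which multiplies the errors by u₂ and by δ, and a quadratic rest.
  have e2 : ∑ i, w i * ⟪z i, g⟫ * ⟪z i, x⟫ - φ⁻¹ * ∑ i, u₁ i * ⟪z i, g⟫ * e i =
      -∑ i, (w' i - w i) * ⟪z i, g⟫ * ⟪z i, x⟫ + φ⁻¹ * (⟪∑ i, (u₂ i * ⟪z i, g⟫ * e i) • z i, δ⟫
      + ∑ i, (u₁' i - u₁ i - u₂ i * ⟪z i, δ⟫) * (⟪z i, g⟫ * e i)
      - ∑ i, (u₁' i * d i - φ * w' i * ⟪z i, δ⟫) * ⟪z i, g⟫) := by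
    have e3 : ∑ i, w i * ⟪z i, g⟫ * ⟪z i, x⟫ = -∑ i, (w' i - w i) * ⟪z i, g⟫ * ⟪z i, x⟫
        + (∑ i, w' i * (⟪z i, x⟫ - ⟪z i, δ⟫) * ⟪z i, g⟫
        + φ⁻¹ * ∑ i, φ * w' i * ⟪z i, δ⟫ * ⟪z i, g⟫) := by
      rw [Finset.mul_sum, ← Finset.sum_neg_distrib, ← Finset.sum_add_distrib,
        ← Finset.sum_add_distrib]
      refine Finset.sum_congr rfl fun i _ => ?_
      field_simp
      ring
    rw [e3, e1, add_sub_assoc, ← mul_add, ← mul_sub]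
    congr 2
    simp only [sum_inner, inner_smul_left, RCLike.conj_to_real]
    rw [← Finset.sum_add_distrib, ← Finset.sum_sub_distrib, ← Finset.sum_add_distrib,
      ← Finset.sum_sub_distrib]
    refine Finset.sum_congr rfl fun i _ => ?_
    ring
  have hδ0 := norm_nonneg δ
  have b1 : |∑ i, (w' i - w i) * ⟪z i, g⟫ * ⟪z i, x⟫| ≤ L * A ^ 2 * K ^ 2 * K₁ * (s * r ^ 2) := by
    have h1 : ∑ i, |(⟪z i, δ⟫ * ⟪z i, g⟫) * ⟪z i, x⟫| ≤
        (A * s * ‖δ‖ * ‖g‖) * (A * s * ‖x‖) :=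
      sum_abs_mul_le_of_sum_sq_le (by positivity) (by positivity)
        (sum_inner_sq_mul_inner_sq_le h4 hA hs.le δ g) (hhi x)
    calc _ ≤ ∑ i, |(w' i - w i) * ⟪z i, g⟫ * ⟪z i, x⟫| := Finset.abs_sum_le_sum_abs _ _
      _ ≤ L * ∑ i, |(⟪z i, δ⟫ * ⟪z i, g⟫) * ⟪z i, x⟫| := by
          rw [Finset.mul_sum]
          refine Finset.sum_le_sum fun i _ => ?_
          rw [abs_mul, abs_mul, abs_mul, abs_mul]
          calc _ ≤ (L * |⟪z i, δ⟫|) * |⟪z i, g⟫| * |⟪z i, x⟫| := by gcongr; exact hw i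
            _ = _ := by ring
      _ ≤ L * ((A * s * ‖δ‖ * ‖g‖) * (A * s * ‖x‖)) := mul_le_mul_of_nonneg_left h1 hL
      _ = L * A ^ 2 * s * (‖δ‖ * (s * ‖g‖) * ‖x‖) := by ring
      _ ≤ L * A ^ 2 * s * ((K * r) * K * (K₁ * r)) := by gcongr
      _ = _ := by ring
  -- δ may depend on the errors. It is therefore taken out by Cauchy-Schwarz from a vector that does
  -- not involve it and whose norm has a second-moment bound.
  have b2 : |⟪∑ i, (u₂ i * ⟪z i, g⟫ * e i) • z i, δ⟫| ≤ K ^ 2 * (s * r ^ 2) := by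
    calc _ ≤ ‖∑ i, (u₂ i * ⟪z i, g⟫ * e i) • z i‖ * ‖δ‖ := abs_real_inner_le_norm _ _
      _ ≤ (K * s * r) * (K * r) := by gcongr
      _ = _ := by ring
  have b3 : |∑ i, (u₁' i - u₁ i - u₂ i * ⟪z i, δ⟫) * (⟪z i, g⟫ * e i)| ≤
      L * A * K ^ 3 * (s * r ^ 2) := by
    have h1 : ∑ i, |⟪z i, δ⟫ ^ 2 * (⟪z i, g⟫ * e i)| ≤ (A * s * ‖δ‖ ^ 2) * K :=
      sum_abs_mul_le_of_sum_sq_le (by positivity) (by positivity)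
        (by simpa only [← pow_mul] using h4 δ) hge
    calc _ ≤ ∑ i, |(u₁' i - u₁ i - u₂ i * ⟪z i, δ⟫) * (⟪z i, g⟫ * e i)| :=
          Finset.abs_sum_le_sum_abs _ _
      _ ≤ L * ∑ i, |⟪z i, δ⟫ ^ 2 * (⟪z i, g⟫ * e i)| := by
          rw [Finset.mul_sum]
          refine Finset.sum_le_sum fun i _ => ?_
          rw [abs_mul, abs_mul (⟪z i, δ⟫ ^ 2), abs_of_nonneg (sq_nonneg ⟪z i, δ⟫), ← mul_assoc]
          gcongr
          exact hu i
      _ ≤ L * ((A * s * ‖δ‖ ^ 2) * K) := mul_le_mul_of_nonneg_left h1 hL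
      _ ≤ L * ((A * s * (K * r) ^ 2) * K) := by gcongr
      _ = _ := by ring
  have b4 : |∑ i, (u₁' i * d i - φ * w' i * ⟪z i, δ⟫) * ⟪z i, g⟫| ≤
      L * A ^ 2 * K ^ 3 * (s * r ^ 2) := by
    have h1 : ∑ i, |⟪z i, δ⟫ ^ 2 * ⟪z i, g⟫| ≤ (A * s * ‖δ‖ ^ 2) * (A * s * ‖g‖) :=
      sum_abs_mul_le_of_sum_sq_le (by positivity) (by positivity)
        (by simpa only [← pow_mul] using h4 δ) (hhi g)
    calc _ ≤ ∑ i, |(u₁' i * d i - φ * w' i * ⟪z i, δ⟫) * ⟪z i, g⟫| :=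
          Finset.abs_sum_le_sum_abs _ _
      _ ≤ L * ∑ i, |⟪z i, δ⟫ ^ 2 * ⟪z i, g⟫| := by
          rw [Finset.mul_sum]
          refine Finset.sum_le_sum fun i _ => ?_
          rw [abs_mul, abs_mul (⟪z i, δ⟫ ^ 2), abs_of_nonneg (sq_nonneg ⟪z i, δ⟫), ← mul_assoc]
          gcongr
          exact hd i
      _ ≤ L * ((A * s * ‖δ‖ ^ 2) * (A * s * ‖g‖)) := mul_le_mul_of_nonneg_left h1 hL
      _ = L * A ^ 2 * s * (‖δ‖ ^ 2 * (s * ‖g‖)) := by ring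
      _ ≤ L * A ^ 2 * s * ((K * r) ^ 2 * K) := by gcongr
      _ = _ := by ring
  rw [e2]
  refine (abs_add_le _ _).trans ?_
  rw [abs_neg, abs_mul, abs_of_pos (inv_pos.2 hφ), add_mul, mul_assoc φ⁻¹]
  refine add_le_add b1 (mul_le_mul_of_nonneg_left ?_ (inv_pos.2 hφ).le)
  refine (abs_sub _ _).trans ((add_le_add_left (abs_add_le _ _) _).trans ?_)
  linarith

end Design

/-! ### Weak convergence: Curtiss' and Slutsky's theorems -/

/-- If the moment generating functions of a weakly convergent sequence of laws converge pointwise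
to finite limits, these limits are the values of the moment generating function of the limit. -/
lemma integrable_and_mgf_eq_of_tendsto {ι : Type*} {l : Filter ι} [l.NeBot]
    {μ : ι → ProbabilityMeasure ℝ} {ν : ProbabilityMeasure ℝ} (hμ : Tendsto μ l (𝓝 ν))
    {m : ℝ → ℝ} (hm : ∀ t, 0 < m t)
    (h : ∀ t, Tendsto (fun i => mgf id (μ i : Measure ℝ) t) l (𝓝 (m t))) (t : ℝ) :
    Integrable (fun x => Real.exp (t * x)) (ν : Measure ℝ) ∧ mgf id (ν : Measure ℝ) t = m t := by
  have hint : ∀ s, ∀ᶠ i in l, Integrable (fun x => Real.exp (s * x)) (μ i : Measure ℝ) := by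
    intro s
    filter_upwards [(h s).eventually (lt_mem_nhds (hm s))] with i hi
    by_contra hc
    simp [mgf_undef (X := id) hc] at hi
  -- Weak convergence tests only bounded functions, so the exponential is truncated. The level is
  -- |K| to make the bound nonnegative for every K.
  let f : ℝ → ℝ → BoundedContinuousFunction ℝ ℝ := fun s K =>
    BoundedContinuousFunction.ofNormedAddCommGroup (fun x => min (Real.exp (s * x)) |K|)
      (by fun_prop) |K| (fun x => by
        rw [Real.norm_eq_abs, abs_of_nonneg (le_min (Real.exp_nonneg _) (abs_nonneg _))]
        exact min_le_right _ _)
  have hf : ∀ s K x, f s K x = min (Real.exp (s * x)) |K| := fun _ _ _ => rfl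
  have hlim : ∀ s K, Tendsto (fun i => ∫ x, f s K x ∂(μ i : Measure ℝ)) l
      (𝓝 (∫ x, f s K x ∂(ν : Measure ℝ))) := fun s K =>
    (ProbabilityMeasure.tendsto_iff_forall_integral_tendsto.1 hμ) (f s K)
  have hle : ∀ s K, ∫ x, f s K x ∂(ν : Measure ℝ) ≤ m s := by
    intro s K
    refine le_of_tendsto_of_tendsto (hlim s K) (h s) ?_
    filter_upwards [hint s] with i hi
    refine integral_mono ((f s K).integrable _) hi fun x => ?_
    rw [hf]; exact min_le_left _ _
  have hint' : ∀ s, Integrable (fun x => Real.exp (s * x)) (ν : Measure ℝ) := by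
    intro s
    have hT : ∀ᵐ x ∂(ν : Measure ℝ), Tendsto (fun k : ℕ => f s k x) atTop
        (𝓝 (Real.exp (s * x))) := by
      refine ae_of_all _ fun x => tendsto_const_nhds.congr' ?_
      filter_upwards [(tendsto_natCast_atTop_atTop (R := ℝ)).eventually_ge_atTop
        (Real.exp (s * x))] with k hk
      rw [hf, Nat.abs_cast, min_eq_left hk]
    refine integrable_of_tendsto hT ?_ ?_
    · exact fun k => (f s k).continuous.aestronglyMeasurable
    · refine ne_top_of_le_ne_top (ENNReal.ofReal_ne_top (r := m s)) ?_
      refine liminf_le_of_frequently_le' (Frequently.of_forall fun k => ?_)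
      have h0 : ∀ x, 0 ≤ f s k x := fun x => le_min (Real.exp_nonneg _) (abs_nonneg _)
      rw [← ofReal_integral_norm_eq_lintegral_enorm ((f s k).integrable _)]
      refine ENNReal.ofReal_le_ofReal (le_trans (le_of_eq ?_) (hle s k))
      exact integral_congr_ae (ae_of_all _ fun x => by simp [abs_of_nonneg (h0 x)])
  refine ⟨hint' t, ?_⟩
  -- the truncation error is at most `exp (2 t x) / K`
  have herr : ∀ K : ℝ, 0 < K → ∀ x : ℝ,
      Real.exp (t * x) - f t K x ≤ K⁻¹ * Real.exp (2 * t * x) := by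
    intro K hK x
    rw [hf, abs_of_pos hK]
    have e : Real.exp (2 * t * x) = Real.exp (t * x) * Real.exp (t * x) := by
      rw [← Real.exp_add]; congr 1; ring
    have hp := Real.exp_pos (t * x)
    rcases le_total (Real.exp (t * x)) K with h1 | h1
    · rw [min_eq_left h1, sub_self]; positivity
    · rw [min_eq_right h1, e, inv_mul_eq_div, le_div_iff₀ hK]
      nlinarith
  -- The generating function at 2t controls the truncation uniformly along the sequence, so no mass
  -- of exp(t x) escapes.
  have hupper : ∀ K : ℝ, 0 < K → m t ≤ ∫ x, f t K x ∂(ν : Measure ℝ) + K⁻¹ * m (2 * t) := by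
    intro K hK
    refine le_of_tendsto_of_tendsto (h t) ((hlim t K).add ((h (2 * t)).const_mul K⁻¹)) ?_
    filter_upwards [hint t, hint (2 * t)] with i h1 h2
    simp only [mgf, id]
    rw [← integral_const_mul, ← integral_add ((f t K).integrable _) (h2.const_mul _)]
    refine integral_mono h1 (((f t K).integrable _).add (h2.const_mul _)) fun x => ?_
    have := herr K hK x
    simp only
    linarith
  have hfν : ∀ K, ∫ x, f t K x ∂(ν : Measure ℝ) ≤ mgf id (ν : Measure ℝ) t := fun K => by
    refine integral_mono ((f t K).integrable _) (hint' t) fun x => ?_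
    rw [hf]; exact min_le_left _ _
  refine le_antisymm ?_ ?_
  · have hT : Tendsto (fun k : ℕ => ∫ x, f t k x ∂(ν : Measure ℝ)) atTop
        (𝓝 (∫ x, Real.exp (t * x) ∂(ν : Measure ℝ))) := by
      refine tendsto_integral_of_dominated_convergence (fun x => Real.exp (t * x))
        (fun k => (f t k).continuous.aestronglyMeasurable) (hint' t) (fun k => ?_) ?_
      · refine ae_of_all _ fun x => ?_
        rw [Real.norm_eq_abs, hf, abs_of_nonneg (le_min (Real.exp_nonneg _) (abs_nonneg _))]
        exact min_le_left _ _
      · refine ae_of_all _ fun x => tendsto_const_nhds.congr' ?_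
        filter_upwards [(tendsto_natCast_atTop_atTop (R := ℝ)).eventually_ge_atTop
          (Real.exp (t * x))] with k hk
        rw [hf, Nat.abs_cast, min_eq_left hk]
    exact le_of_tendsto' hT fun k => hle t k
  · have hT : Tendsto (fun K : ℝ => mgf id (ν : Measure ℝ) t + K⁻¹ * m (2 * t)) atTop
        (𝓝 (mgf id (ν : Measure ℝ) t + 0 * m (2 * t))) :=
      tendsto_const_nhds.add (tendsto_inv_atTop_zero.mul_const _)
    rw [zero_mul, add_zero] at hT
    refine ge_of_tendsto hT ?_
    filter_upwards [eventually_gt_atTop 0] with K hK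
    linarith [hupper K hK, hfν K]

/-- A law whose moment generating function is finite everywhere is determined by it. -/
lemma probabilityMeasure_eq_of_mgf_eq {μ ν : Measure ℝ} [IsProbabilityMeasure μ]
    [IsProbabilityMeasure ν] (hμ : ∀ t, Integrable (fun x => Real.exp (t * x)) μ)
    (h : mgf id μ = mgf id ν) : μ = ν := by
  refine Measure.ext_of_complexMGF_id_eq (funext fun z => ?_)
  have hset : integrableExpSet id μ = Set.univ := Set.eq_univ_of_forall hμ
  exact eqOn_complexMGF_of_mgf h (by simp [hset])

/-- **Curtiss' theorem** for the standard normal limit. -/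
theorem tendsto_gaussianReal_of_tendsto_mgf {μ : ℕ → ProbabilityMeasure ℝ}
    (h : ∀ t, Tendsto (fun n => mgf id (μ n : Measure ℝ) t) atTop (𝓝 (Real.exp (t ^ 2 / 2)))) :
    Tendsto μ atTop (𝓝 ⟨gaussianReal 0 1, inferInstance⟩) := by
  have hev : ∀ t, ∀ᶠ n in atTop, Integrable (fun x => Real.exp (t * x)) (μ n : Measure ℝ) ∧
      mgf id (μ n : Measure ℝ) t < Real.exp (t ^ 2 / 2) + 1 := by
    intro t
    filter_upwards [(h t).eventually (lt_mem_nhds (Real.exp_pos _)),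
      (h t).eventually (gt_mem_nhds (lt_add_one _))] with n hn hn'
    refine ⟨?_, hn'⟩
    by_contra hc
    simp [mgf_undef (X := id) hc] at hn
  obtain ⟨N, hN⟩ := eventually_atTop.1 ((hev 1).and (hev (-1)))
  -- After dropping N terms the generating functions at 1 and -1 are bounded for all indices.
  -- Chernoff's inequality then gives uniform exponential tails, hence tightness.
  rw [← tendsto_add_atTop_iff_nat N]
  set ρ : ℕ → ProbabilityMeasure ℝ := fun n => μ (n + N) with hρ
  have hρm : ∀ t, Tendsto (fun n => mgf id (ρ n : Measure ℝ) t) atTop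
      (𝓝 (Real.exp (t ^ 2 / 2))) := fun t => (h t).comp (tendsto_add_atTop_nat N)
  set C : ℝ := Real.exp (1 / 2) + 1
  have htail : ∀ n, ∀ r : ℝ,
      (ρ n : Measure ℝ) {x | r < ‖x‖} ≤ ENNReal.ofReal (Real.exp (-r) * (2 * C)) := by
    intro n r
    obtain ⟨⟨h1, h2⟩, h3, h4⟩ := hN (n + N) (Nat.le_add_left _ _)
    have a1 := measure_ge_le_exp_mul_mgf (μ := (ρ n : Measure ℝ)) (X := id) r zero_le_one h1
    have a2 := measure_le_le_exp_mul_mgf (μ := (ρ n : Measure ℝ)) (X := id) (-r)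
      (by norm_num : (-1 : ℝ) ≤ 0) h3
    have a3 : {x : ℝ | r < ‖x‖} ⊆ {x | r ≤ id x} ∪ {x | id x ≤ -r} := by
      intro x hx
      simp only [Set.mem_ofPred_eq, Real.norm_eq_abs, lt_abs] at hx
      rcases hx with hx | hx
      · exact Or.inl hx.le
      · exact Or.inr (by simp only [Set.mem_ofPred_eq, id]; linarith)
    have a4 : (ρ n : Measure ℝ).real {x | r < ‖x‖} ≤ Real.exp (-r) * (2 * C) := by
      refine (measureReal_mono a3).trans ((measureReal_union_le _ _).trans ?_)
      have b1 : Real.exp (-1 * r) * mgf id (ρ n : Measure ℝ) 1 ≤ Real.exp (-r) * C := by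
        rw [neg_one_mul]
        exact mul_le_mul_of_nonneg_left (by simpa [C] using h2.le) (Real.exp_nonneg _)
      have b2 : Real.exp (- -1 * -r) * mgf id (ρ n : Measure ℝ) (-1) ≤ Real.exp (-r) * C := by
        rw [neg_neg, one_mul]
        exact mul_le_mul_of_nonneg_left (by simpa [C] using h4.le) (Real.exp_nonneg _)
      linarith
    rw [← ofReal_measureReal]
    exact ENNReal.ofReal_le_ofReal a4
  have htight : IsTightMeasureSet {((ρ n : ProbabilityMeasure ℝ) : Measure ℝ) | n} := by
    refine isTightMeasureSet_of_tendsto_measure_norm_gt ?_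
    have hT : Tendsto (fun r : ℝ => ENNReal.ofReal (Real.exp (-r) * (2 * C))) atTop (𝓝 0) := by
      have := ENNReal.tendsto_ofReal
        ((Real.tendsto_exp_neg_atTop_nhds_zero).mul_const (2 * C))
      simpa using this
    refine tendsto_of_tendsto_of_tendsto_of_le_of_le tendsto_const_nhds hT
      (fun _ => zero_le) fun r => ?_
    refine iSup₂_le ?_
    rintro _ ⟨n, rfl⟩
    exact htail n r
  -- Tightness gives every ultrafilter a limit law, by Prokhorov's theorem. Its generating function
  -- is that of the standard normal law, which determines it.
  refine (Filter.tendsto_iff_ultrafilter _ _ _).2 fun U hU => ?_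
  have hcompact : IsCompact (closure {ρ n | n}) :=
    isCompact_closure_of_isTightMeasureSet (by simpa using htight)
  obtain ⟨ν, -, hν : Tendsto _ _ _⟩ := hcompact.ultrafilter_le_nhds (U.map ρ)
    (.trans (by simp) (monotone_principal subset_closure))
  have key := integrable_and_mgf_eq_of_tendsto (l := (U : Filter ℕ)) (μ := ρ) (ν := ν) hν
    (m := fun t => Real.exp (t ^ 2 / 2)) (fun t => Real.exp_pos _) (fun t => (hρm t).mono_left hU)
  have heq : (ν : Measure ℝ) = gaussianReal 0 1 := by
    refine probabilityMeasure_eq_of_mgf_eq (fun t => (key t).1) (funext fun t => ?_)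
    rw [(key t).2, mgf_id_gaussianReal]
    simp
  have : ν = ⟨gaussianReal 0 1, inferInstance⟩ := Subtype.ext heq
  rw [← this]
  exact hν

/-- **Slutsky's theorem** on varying probability spaces: a perturbation that vanishes in
probability does not affect the limit in distribution. -/
theorem tendstoInDistribution_of_tendsto_measure_sub {Ω : ℕ → Type*} [∀ n, MeasurableSpace (Ω n)]
    {P : ∀ n, Measure (Ω n)} [∀ n, IsProbabilityMeasure (P n)] {X Y : ∀ n, Ω n → ℝ}
    {Ω' : Type*} [MeasurableSpace Ω'] {P' : Measure Ω'} [IsProbabilityMeasure P'] {Z : Ω' → ℝ}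
    (hX : TendstoInDistribution X atTop Z P P') (hY : ∀ n, AEMeasurable (Y n) (P n))
    (h : ∀ ε : ℝ, 0 < ε → Tendsto (fun n => (P n).real {ω | ε < |Y n ω - X n ω|}) atTop (𝓝 0)) :
    TendstoInDistribution Y atTop Z P P' := by
  refine ⟨hY, hX.aemeasurable_limit, ?_⟩
  refine ProbabilityMeasure.tendsto_of_tendsto_charFun fun t => ?_
  have hXt := ProbabilityMeasure.tendsto_iff_tendsto_charFun.1 hX.tendsto t
  simp only [ProbabilityMeasure.coe_mk] at hXt ⊢
  refine hXt.congr_dist ?_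
  rw [Metric.tendsto_atTop]
  intro ε hε
  set d : ℝ := ε / (2 * (|t| + 1)) with hd
  have hd0 : 0 < d := by positivity
  obtain ⟨N, hN⟩ := Metric.tendsto_atTop.1 (h d hd0) (ε / 4) (by positivity)
  refine ⟨N, fun n hn => ?_⟩
  have hNn := hN n hn
  rw [Real.dist_eq, sub_zero, abs_of_nonneg measureReal_nonneg] at hNn
  rw [Real.dist_eq, sub_zero, abs_of_nonneg dist_nonneg, dist_eq_norm]
  have hXm := hX.forall_aemeasurable n
  have hYm := hY n
  rw [charFun_apply_real, charFun_apply_real, integral_map hXm (by fun_prop),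
    integral_map hYm (by fun_prop)]
  have hi : ∀ W : Ω n → ℝ, AEMeasurable W (P n) →
      Integrable (fun ω => Complex.exp (t * W ω * Complex.I)) (P n) := by
    intro W hW
    refine Integrable.of_bound (by fun_prop) 1 (ae_of_all _ fun ω => ?_)
    rw [← Complex.ofReal_mul, Complex.norm_exp_ofReal_mul_I]
  rw [← integral_sub (hi _ hXm) (hi _ hYm)]
  have hmeas : NullMeasurableSet {ω | d < |Y n ω - X n ω|} (P n) :=
    nullMeasurableSet_lt aemeasurable_const (by fun_prop)
  have hbound : ∀ ω, ‖Complex.exp (t * X n ω * Complex.I) - Complex.exp (t * Y n ω * Complex.I)‖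
      ≤ |t| * d + {ω | d < |Y n ω - X n ω|}.indicator (fun _ => (2 : ℝ)) ω := by
    intro ω
    rw [← Complex.ofReal_mul, ← Complex.ofReal_mul]
    by_cases hω : d < |Y n ω - X n ω|
    · rw [Set.indicator_of_mem (by exact hω)]
      refine (norm_sub_le _ _).trans ?_
      rw [Complex.norm_exp_ofReal_mul_I, Complex.norm_exp_ofReal_mul_I]
      have : 0 ≤ |t| * d := by positivity
      linarith
    · rw [Set.indicator_of_notMem (by exact hω), add_zero]
      have e : Complex.exp (((t * X n ω : ℝ) : ℂ) * Complex.I)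
          - Complex.exp (((t * Y n ω : ℝ) : ℂ) * Complex.I)
          = Complex.exp (((t * Y n ω : ℝ) : ℂ) * Complex.I) *
            (Complex.exp (Complex.I * ((t * (X n ω - Y n ω) : ℝ) : ℂ)) - 1) := by
        rw [mul_sub, mul_one, ← Complex.exp_add]
        congr 2
        push_cast; ring
      rw [e, norm_mul, Complex.norm_exp_ofReal_mul_I, one_mul]
      refine (Real.norm_exp_I_mul_ofReal_sub_one_le).trans ?_
      rw [Real.norm_eq_abs, abs_mul, abs_sub_comm]
      exact mul_le_mul_of_nonneg_left (not_lt.1 hω) (abs_nonneg _)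
  have hind : Integrable ({ω | d < |Y n ω - X n ω|}.indicator fun _ => (2 : ℝ)) (P n) :=
    (integrable_const _).indicator₀ hmeas
  calc _ ≤ ∫ ω, ‖Complex.exp (t * X n ω * Complex.I) - Complex.exp (t * Y n ω * Complex.I)‖ ∂(P n) :=
        norm_integral_le_integral_norm _
    _ ≤ ∫ ω, (|t| * d + {ω | d < |Y n ω - X n ω|}.indicator (fun _ => (2 : ℝ)) ω) ∂(P n) :=
        integral_mono ((hi _ hXm).sub (hi _ hYm)).norm ((integrable_const _).add hind) hbound
    _ = |t| * d + (P n).real {ω | d < |Y n ω - X n ω|} * 2 := by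
        rw [integral_add (integrable_const _) hind, integral_indicator₀ hmeas]
        simp
    _ < ε := by
        have h1 : |t| * d ≤ ε / 2 := by
          rw [hd, mul_div_assoc', div_le_div_iff₀ (by positivity) (by positivity)]
          nlinarith [abs_nonneg t]
        linarith

/-! ### Mean value and Taylor inequalities -/

lemma abs_sub_le_of_hasDerivAt {f f' : ℝ → ℝ} {a b C : ℝ}
    (hf : ∀ s ∈ Set.uIcc a b, HasDerivAt f (f' s) s) (hC : ∀ s ∈ Set.uIcc a b, |f' s| ≤ C) :
    |f b - f a| ≤ C * |b - a| :=
  (convex_uIcc a b).norm_image_sub_le_of_norm_hasDerivWithin_le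
    (fun s hs => (hf s hs).hasDerivWithinAt) hC Set.left_mem_uIcc Set.right_mem_uIcc

lemma abs_sub_le_abs_of_mem_uIcc {a b s : ℝ} (hs : s ∈ Set.uIcc a b) : |s - a| ≤ |b - a| :=
  Set.abs_sub_left_of_mem_uIcc hs

lemma abs_sub_sub_mul_le_of_hasDerivAt {f f' : ℝ → ℝ} {a b c C : ℝ}
    (hf : ∀ s ∈ Set.uIcc a b, HasDerivAt f (f' s) s) (hC : ∀ s ∈ Set.uIcc a b, |f' s - c| ≤ C) :
    |f b - f a - c * (b - a)| ≤ C * |b - a| := by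
  have h := abs_sub_le_of_hasDerivAt (f := fun s => f s - c * s) (f' := fun s => f' s - c)
    (fun s hs => by
      have := HasDerivAt.fun_sub (hf s hs) (hasDerivAt_const_mul c (x := s))
      exact this) hC
  calc |f b - f a - c * (b - a)| = |f b - c * b - (f a - c * a)| := by congr 1; ring
    _ ≤ C * |b - a| := h

/-- First order Taylor expansion with remainder bounded by a Lipschitz constant of `f'`. -/
lemma abs_sub_sub_mul_le_mul_sq_of_hasDerivAt {f f' : ℝ → ℝ} {a b c C : ℝ}
    (hf : ∀ s ∈ Set.uIcc a b, HasDerivAt f (f' s) s)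
    (hC : ∀ s ∈ Set.uIcc a b, |f' s - c| ≤ C * |b - a|) :
    |f b - f a - c * (b - a)| ≤ C * (b - a) ^ 2 := by
  refine (abs_sub_sub_mul_le_of_hasDerivAt hf hC).trans (le_of_eq ?_)
  rw [mul_assoc, ← sq, sq_abs]

/-! ### Local expansions of the model functions -/

namespace GLM

variable (M : GLM)

/-- The model functions are bounded by `C` at the linear predictor `η ∈ D`. -/
structure BoundedAt (C η : ℝ) : Prop where
  mem : η ∈ M.D
  deriv_h : |deriv M.h η| ≤ C
  deriv_u : |deriv M.u η| ≤ C
  deriv2_u : |iteratedDeriv 2 M.u η| ≤ C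
  deriv3_u : |iteratedDeriv 3 M.u η| ≤ C
  w : |M.w η| ≤ C
  deriv_w : |deriv M.w η| ≤ C

variable {M}

section Smooth

variable (hu : ContDiffOn ℝ 3 M.u M.D) (hw : ContDiffOn ℝ 1 M.w M.D)
include hu

lemma hasDerivAt_iteratedDeriv_u {η : ℝ} (hη : η ∈ M.D) {k : ℕ} (hk : k < 3) :
    HasDerivAt (iteratedDeriv k M.u) (iteratedDeriv (k + 1) M.u η) η := by
  have h1 : ∀ k m : ℕ, k + m = 3 → ContDiffOn ℝ m (iteratedDeriv k M.u) M.D := by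
    intro k
    induction k with
    | zero => rintro m hm; obtain rfl : m = 3 := by omega
              simpa using hu
    | succ k ih =>
      intro m hm
      rw [iteratedDeriv_succ]
      exact (ih (m + 1) (by omega)).deriv_of_isOpen M.D_open (by norm_cast)
  rw [iteratedDeriv_succ]
  have h2 := (h1 k (3 - k) (by omega)).differentiableOn (by norm_cast; omega)
  exact (h2.differentiableAt (M.D_open.mem_nhds hη)).hasDerivAt

lemma hasDerivAt_u {η : ℝ} (hη : η ∈ M.D) : HasDerivAt M.u (deriv M.u η) η := by
  simpa using hasDerivAt_iteratedDeriv_u hu hη (k := 0) (by norm_num)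

lemma hasDerivAt_deriv_u {η : ℝ} (hη : η ∈ M.D) :
    HasDerivAt (deriv M.u) (iteratedDeriv 2 M.u η) η := by
  simpa using hasDerivAt_iteratedDeriv_u hu hη (k := 1) (by norm_num)

/-- On D the function h coincides with b' ∘ u, so it inherits differentiability from u and from the
analyticity of b. -/
lemma hasDerivAt_h {η : ℝ} (hη : η ∈ M.D) :
    HasDerivAt M.h (deriv (deriv M.b) (M.u η) * deriv M.u η) η := by
  have h1 := (M.analyticAt_b (M.u_mem hη)).deriv.differentiableAt.hasDerivAt
  have h2 := h1.comp η (hasDerivAt_u hu hη)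
  refine h2.congr_of_eventuallyEq ?_
  filter_upwards [M.D_open.mem_nhds hη] with s hs
  exact (M.deriv_b_u hs).symm

lemma phi_mul_deriv_h {η : ℝ} (hη : η ∈ M.D) : M.φ * deriv M.h η = M.v η * deriv M.u η := by
  rw [(hasDerivAt_h hu hη).deriv, v, mul_assoc]

/-- This identity makes Fisher scoring work: the derivative of the mean, weighted as in the score,
is the Fisher weight. -/
lemma phi_mul_w {η : ℝ} (hη : η ∈ M.D) : M.φ * M.w η = deriv M.u η * deriv M.h η := by
  have h1 := phi_mul_deriv_h hu hη
  have h2 := (M.v_pos hη).ne'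
  rw [w]
  field_simp
  linear_combination (deriv M.h η) * h1

lemma w_eq {η : ℝ} (hη : η ∈ M.D) : M.w η = (M.φ⁻¹ * deriv M.u η) ^ 2 * M.v η := by
  have h1 := phi_mul_deriv_h hu hη
  have h2 := phi_mul_w hu hη
  have h3 := M.φ_pos.ne'
  field_simp
  linear_combination M.φ * h2 + (deriv M.u η) * h1

variable {C η η' : ℝ} (hC : ∀ s ∈ Set.uIcc η η', M.BoundedAt C s)
include hC

lemma abs_deriv_u_sub_le : |deriv M.u η' - deriv M.u η| ≤ C * |η' - η| :=
  abs_sub_le_of_hasDerivAt (fun s hs => hasDerivAt_deriv_u hu (hC s hs).mem)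
    (fun s hs => (hC s hs).deriv2_u)

lemma abs_deriv_u_sub_sub_le :
    |deriv M.u η' - deriv M.u η - iteratedDeriv 2 M.u η * (η' - η)| ≤ C * (η' - η) ^ 2 := by
  have hC0 : 0 ≤ C := (abs_nonneg _).trans (hC η Set.left_mem_uIcc).deriv_u
  refine abs_sub_sub_mul_le_mul_sq_of_hasDerivAt (fun s hs => hasDerivAt_deriv_u hu (hC s hs).mem) fun s hs => ?_
  have hsub := Set.uIcc_subset_uIcc_left hs
  refine (abs_sub_le_of_hasDerivAt (fun t ht => hasDerivAt_iteratedDeriv_u hu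
    (hC t (hsub ht)).mem (k := 2) (by norm_num)) fun t ht => (hC t (hsub ht)).deriv3_u).trans ?_
  exact mul_le_mul_of_nonneg_left (abs_sub_le_abs_of_mem_uIcc hs) hC0

omit hu in
include hw in
lemma abs_w_sub_le : |M.w η' - M.w η| ≤ C * |η' - η| :=
  abs_sub_le_of_hasDerivAt (fun s hs => ((hw.differentiableOn (by norm_num)).differentiableAt
    (M.D_open.mem_nhds (hC s hs).mem)).hasDerivAt) (fun s hs => (hC s hs).deriv_w)

include hw in
-- The factor u' is frozen at η' and only h varies. The slope u'(η') h'(s) then differs from φ w(η')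
-- by a Lipschitz error, since φ w(s) = u'(s) h'(s).
lemma abs_deriv_u_mul_h_sub_le :
    |deriv M.u η' * (M.h η' - M.h η) - M.φ * M.w η' * (η' - η)| ≤
      (C ^ 2 + M.φ * C) * (η' - η) ^ 2 := by
  have hC0 : 0 ≤ C := (abs_nonneg _).trans (hC η Set.left_mem_uIcc).deriv_u
  have hφ := M.φ_pos
  rw [mul_sub]
  refine abs_sub_sub_mul_le_mul_sq_of_hasDerivAt (f := fun s => deriv M.u η' * M.h s)
    (f' := fun s => deriv M.u η' * deriv M.h s)
    (fun s hs => ?_) fun s hs => ?_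
  · have := (hasDerivAt_h hu (hC s hs).mem).differentiableAt.hasDerivAt
    exact this.const_mul _
  · have hsub : Set.uIcc s η' ⊆ Set.uIcc η η' := Set.uIcc_subset_uIcc_right hs
    have h1 := abs_deriv_u_sub_le hu fun t ht => hC t (hsub ht)
    have h2 := abs_w_sub_le hw fun t ht => hC t (hsub ht)
    have h3 : |η' - s| ≤ |η' - η| := Set.abs_sub_right_of_mem_uIcc hs
    have h4 := (hC s hs).deriv_h
    have e : deriv M.u η' * deriv M.h s - M.φ * M.w η' =
        (deriv M.u η' - deriv M.u s) * deriv M.h s - M.φ * (M.w η' - M.w s) := by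
      rw [mul_sub, phi_mul_w hu (hC s hs).mem]; ring
    rw [e]
    refine (abs_sub _ _).trans ?_
    rw [abs_mul, abs_mul, abs_of_pos hφ]
    calc _ ≤ (C * |η' - s|) * C + M.φ * (C * |η' - s|) := by gcongr
      _ ≤ (C * |η' - η|) * C + M.φ * (C * |η' - η|) := by gcongr
      _ = _ := by ring

end Smooth

section Tilt

variable (hu : ContDiffOn ℝ 3 M.u M.D) (hw : ContDiffOn ℝ 1 M.w M.D)
  {C η ρ c₀ : ℝ} (hρ : 0 ≤ ρ) (hC : ∀ s ∈ Set.Icc (η - ρ) (η + ρ), M.BoundedAt C s)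
  (hc₀ : 0 < c₀) (hc : c₀ ≤ |deriv M.u η|) (hCρ : C * ρ ≤ c₀ / 2)
include hu hρ hC hc hCρ

omit hc hCρ in
lemma abs_deriv_u_sub_le_of_mem_Icc {s : ℝ} (hs : s ∈ Set.Icc (η - ρ) (η + ρ)) :
    |deriv M.u s - deriv M.u η| ≤ C * ρ := by
  have hη : η ∈ Set.Icc (η - ρ) (η + ρ) := ⟨by linarith, by linarith⟩
  have hC0 : 0 ≤ C := (abs_nonneg _).trans (hC η hη).deriv_u
  refine (abs_deriv_u_sub_le hu fun t ht => hC t (Set.uIcc_subset_Icc hη hs ht)).trans ?_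
  exact mul_le_mul_of_nonneg_left (abs_le.2 ⟨by linarith [hs.1], by linarith [hs.2]⟩) hC0

/-- Every canonical parameter near `u η` belongs to a linear predictor near `η`. -/
lemma uIcc_subset_image_u {τ : ℝ} (hτ : |τ| ≤ ρ * c₀ / 2) :
    Set.uIcc (M.u η) (M.u η + τ) ⊆ M.u '' Set.Icc (η - ρ) (η + ρ) := by
  have hle : η - ρ ≤ η + ρ := by linarith
  have hη : η ∈ Set.Icc (η - ρ) (η + ρ) := ⟨by linarith, by linarith⟩
  have hcont : ContinuousOn M.u (Set.uIcc (η - ρ) (η + ρ)) := fun s hs =>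
    (hasDerivAt_u hu (hC s (by rwa [Set.uIcc_of_le hle] at hs)).mem).continuousAt.continuousWithinAt
  have hivt := intermediate_value_uIcc hcont
  rw [Set.uIcc_of_le hle] at hivt
  refine Set.Subset.trans ?_ hivt
  -- At both ends of the interval u moves by at least c₀ ρ - C ρ² ≥ c₀ ρ / 2, in opposite
  -- directions. The sign of u'(η) decides which end goes up, and the intermediate value theorem
  -- covers everything between.
  have hstep : ∀ s ∈ Set.Icc (η - ρ) (η + ρ),
      |M.u s - M.u η - deriv M.u η * (s - η)| ≤ C * ρ * ρ := by
    intro s hs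
    have hsub := Set.uIcc_subset_Icc hη hs
    have h := abs_sub_sub_mul_le_of_hasDerivAt (c := deriv M.u η)
      (fun t ht => hasDerivAt_u hu (hC t (hsub ht)).mem)
      (fun t ht => abs_deriv_u_sub_le_of_mem_Icc hu hρ hC (hsub ht))
    have hC0 : 0 ≤ C := (abs_nonneg _).trans (hC η hη).deriv_u
    calc _ ≤ C * ρ * |s - η| := h
      _ ≤ C * ρ * ρ := mul_le_mul_of_nonneg_left
          (abs_le.2 ⟨by linarith [hs.1], by linarith [hs.2]⟩) (by positivity)
  have h1 := abs_le.1 (hstep (η + ρ) ⟨by linarith, le_rfl⟩)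
  have h2 := abs_le.1 (hstep (η - ρ) ⟨le_rfl, by linarith⟩)
  have h3 : C * ρ * ρ ≤ c₀ / 2 * ρ := mul_le_mul_of_nonneg_right hCρ hρ
  have h4 := abs_le.1 hτ
  rcases le_total 0 (deriv M.u η) with h5 | h5
  · rw [abs_of_nonneg h5] at hc
    have h6 := mul_le_mul_of_nonneg_right hc hρ
    refine Set.uIcc_subset_uIcc ?_ ?_ <;> refine Set.mem_uIcc_of_le ?_ ?_ <;> nlinarith
  · rw [abs_of_nonpos h5] at hc
    have h6 := mul_le_mul_of_nonneg_right hc hρ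
    refine Set.uIcc_subset_uIcc ?_ ?_ <;> refine Set.mem_uIcc_of_ge ?_ ?_ <;> nlinarith

include hw hc₀ in
/-- The variance function is Lipschitz where `u'` is bounded away from zero. -/
lemma abs_v_sub_le {s : ℝ} (hs : s ∈ Set.Icc (η - ρ) (η + ρ)) :
    |M.v s - M.v η| ≤ 12 * M.φ ^ 2 * C ^ 3 / c₀ ^ 4 * ρ := by
  have hη : η ∈ Set.Icc (η - ρ) (η + ρ) := ⟨by linarith, by linarith⟩
  have hC0 : 0 ≤ C := (abs_nonneg _).trans (hC η hη).deriv_u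
  have hφ := M.φ_pos
  have hsub := Set.uIcc_subset_Icc hη hs
  have h1 := abs_deriv_u_sub_le_of_mem_Icc hu hρ hC hs
  have h2 : |M.w s - M.w η| ≤ C * ρ := by
    refine (abs_w_sub_le hw fun t ht => hC t (hsub ht)).trans ?_
    exact mul_le_mul_of_nonneg_left (abs_le.2 ⟨by linarith [hs.1], by linarith [hs.2]⟩) hC0
  have h3 : c₀ / 2 ≤ |deriv M.u s| := by
    have := abs_sub_abs_le_abs_sub (deriv M.u η) (deriv M.u s)
    rw [abs_sub_comm] at this
    linarith
  have hus : deriv M.u s ≠ 0 := abs_pos.1 (by linarith)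
  have huη : deriv M.u η ≠ 0 := abs_pos.1 (by linarith)
  have e1 := w_eq hu (hC s hs).mem
  have e2 := w_eq hu (hC η hη).mem
  -- Cross-multiplied difference of v = φ² w / u'². The constant 12 is 3 · 4: the numerator is at
  -- most 3 C³ ρ, and |u' s| ≥ c₀ / 2 costs the factor 4.
  have e3 : (M.v s - M.v η) * (deriv M.u s ^ 2 * deriv M.u η ^ 2) =
      M.φ ^ 2 * ((M.w s - M.w η) * deriv M.u η ^ 2 +
        M.w η * ((deriv M.u η - deriv M.u s) * (deriv M.u η + deriv M.u s))) := by
    rw [e1, e2]; field_simp; ring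
  have h4 : |M.v s - M.v η| * (|deriv M.u s| ^ 2 * |deriv M.u η| ^ 2) ≤
      M.φ ^ 2 * (3 * C ^ 3 * ρ) := by
    rw [← abs_pow, ← abs_pow, ← abs_mul, ← abs_mul, e3, abs_mul, abs_of_pos (pow_pos hφ 2)]
    refine mul_le_mul_of_nonneg_left ((abs_add_le _ _).trans ?_) (by positivity)
    rw [abs_mul, abs_mul, abs_mul, abs_pow, abs_sub_comm (deriv M.u η)]
    have h5 : |deriv M.u η + deriv M.u s| ≤ C + C :=
      (abs_add_le _ _).trans (add_le_add (hC η hη).deriv_u (hC s hs).deriv_u)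
    have h6 := (hC η hη).deriv_u
    have h7 := (hC η hη).w
    calc _ ≤ (C * ρ) * C ^ 2 + C * ((C * ρ) * (C + C)) := by gcongr
      _ = _ := by ring
  have h8 : c₀ ^ 4 / 4 ≤ |deriv M.u s| ^ 2 * |deriv M.u η| ^ 2 := by
    calc c₀ ^ 4 / 4 = (c₀ / 2) ^ 2 * c₀ ^ 2 := by ring
      _ ≤ _ := by gcongr
  have h9 := (mul_le_mul_of_nonneg_left h8 (abs_nonneg (M.v s - M.v η))).trans h4
  rw [div_mul_eq_mul_div, le_div_iff₀ (by positivity)]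
  linarith

include hw hc₀ in
/-- Second order expansion of the cumulant function of a response at a small tilt. -/
lemma abs_cumulant_sub_le {τ : ℝ} (hτ : |τ| ≤ ρ * c₀ / 2) :
    M.u η + τ ∈ M.Θ ∧
    |(M.b (M.u η + τ) - M.b (M.u η)) / M.φ - τ / M.φ * M.h η - (τ / M.φ) ^ 2 * M.v η / 2| ≤
      (τ / M.φ) ^ 2 * (12 * M.φ ^ 2 * C ^ 3 / c₀ ^ 4 * ρ) := by
  have hη : η ∈ Set.Icc (η - ρ) (η + ρ) := ⟨by linarith, by linarith⟩
  have hC0 : 0 ≤ C := (abs_nonneg _).trans (hC η hη).deriv_u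
  have hφ := M.φ_pos
  have himg := uIcc_subset_image_u hu hρ hC hc hCρ hτ
  have hΘ : ∀ ϑ ∈ Set.uIcc (M.u η) (M.u η + τ), ϑ ∈ M.Θ := by
    intro ϑ hϑ
    obtain ⟨s, hs, rfl⟩ := himg hϑ
    exact M.u_mem (hC s hs).mem
  refine ⟨hΘ _ Set.right_mem_uIcc, ?_⟩
  set V : ℝ := 12 * M.φ ^ 2 * C ^ 3 / c₀ ^ 4 * ρ with hV
  have hV0 : 0 ≤ V := by positivity
  -- Each ϑ between the two parameters is u s for some s near η, so the oscillation of b'' is that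
  -- of v / φ. No third derivative of b has to be bounded.
  have hb2 : ∀ ϑ ∈ Set.uIcc (M.u η) (M.u η + τ),
      |deriv (deriv M.b) ϑ - deriv (deriv M.b) (M.u η)| ≤ V / M.φ := by
    intro ϑ hϑ
    obtain ⟨s, hs, rfl⟩ := himg hϑ
    have := abs_v_sub_le hu hw hρ hC hc₀ hc hCρ hs
    rw [v, v, ← mul_sub, abs_mul, abs_of_pos hφ] at this
    rw [le_div_iff₀ hφ]
    linarith
  have hb1 : ∀ ϑ ∈ Set.uIcc (M.u η) (M.u η + τ),
      |deriv M.b ϑ - deriv M.b (M.u η) - deriv (deriv M.b) (M.u η) * (ϑ - M.u η)| ≤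
        V / M.φ * |τ| := by
    intro ϑ hϑ
    have hsub := Set.uIcc_subset_uIcc_left hϑ
    have h := abs_sub_sub_mul_le_of_hasDerivAt (c := deriv (deriv M.b) (M.u η))
      (fun t ht => (M.analyticAt_b (hΘ t (hsub ht))).deriv.differentiableAt.hasDerivAt)
      (fun t ht => hb2 t (hsub ht))
    calc _ ≤ V / M.φ * |ϑ - M.u η| := h
      _ ≤ V / M.φ * |τ| := by
          refine mul_le_mul_of_nonneg_left ?_ (by positivity)
          simpa using abs_sub_le_abs_of_mem_uIcc hϑ
  have h := abs_sub_le_of_hasDerivAt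
    (f := fun t => M.b t - deriv M.b (M.u η) * t
      - deriv (deriv M.b) (M.u η) / 2 * (t - M.u η) ^ 2)
    (f' := fun t => deriv M.b t - deriv M.b (M.u η) - deriv (deriv M.b) (M.u η) * (t - M.u η))
    (a := M.u η) (b := M.u η + τ) (C := V / M.φ * |τ|) (fun t ht => by
      have h1 := ((M.analyticAt_b (hΘ t ht)).differentiableAt.hasDerivAt).sub
          ((hasDerivAt_id t).const_mul (deriv M.b (M.u η)))
      have h2 := (((hasDerivAt_id t).sub_const (M.u η)).pow 2).const_mul
        (deriv (deriv M.b) (M.u η) / 2)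
      refine (h1.sub h2).congr_deriv ?_
      simp only [id]
      push_cast
      ring) hb1
  rw [← M.deriv_b_u (hC η hη).mem, v]
  have e : (M.b (M.u η + τ) - M.b (M.u η)) / M.φ - τ / M.φ * deriv M.b (M.u η)
      - (τ / M.φ) ^ 2 * (M.φ * deriv (deriv M.b) (M.u η)) / 2 =
      (M.b (M.u η + τ) - deriv M.b (M.u η) * (M.u η + τ)
        - deriv (deriv M.b) (M.u η) / 2 * (M.u η + τ - M.u η) ^ 2
        - (M.b (M.u η) - deriv M.b (M.u η) * M.u η
          - deriv (deriv M.b) (M.u η) / 2 * (M.u η - M.u η) ^ 2)) / M.φ := by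
    field_simp
    ring
  rw [e, abs_div, abs_of_pos hφ, div_le_iff₀ hφ]
  refine h.trans (le_of_eq ?_)
  rw [add_sub_cancel_left, mul_assoc, ← sq, sq_abs]
  field_simp

end Tilt

end GLM

/-! ### Quadratic forms and matrix square roots -/

lemma EuclideanSpace.real_inner_eq_dotProduct {p : ℕ} (x y : EuclideanSpace ℝ (Fin p)) :
    ⟪x, y⟫ = x.ofLp ⬝ᵥ y.ofLp := by
  rw [EuclideanSpace.inner_eq_star_dotProduct, star_trivial, dotProduct_comm]

lemma dotProduct_self_eq_norm_sq {p : ℕ} (x : EuclideanSpace ℝ (Fin p)) :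
    x.ofLp ⬝ᵥ x.ofLp = ‖x‖ ^ 2 := by
  rw [← EuclideanSpace.real_inner_eq_dotProduct, real_inner_self_eq_norm_sq]

lemma sum_smul_vecMulVec_mulVec {n p : ℕ} (c : Fin n → ℝ) (z : Fin n → EuclideanSpace ℝ (Fin p))
    (x : EuclideanSpace ℝ (Fin p)) :
    (∑ i, c i • Matrix.vecMulVec (z i).ofLp (z i).ofLp) *ᵥ x.ofLp
      = (∑ i, (c i * ⟪z i, x⟫) • z i).ofLp := by
  rw [Matrix.sum_mulVec, WithLp.ofLp_sum]
  refine Finset.sum_congr rfl fun i _ => ?_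
  rw [Matrix.smul_mulVec, Matrix.vecMulVec_mulVec, WithLp.ofLp_smul,
    EuclideanSpace.real_inner_eq_dotProduct, mul_smul]
  ext j
  simp

lemma dotProduct_sum_smul_vecMulVec_mulVec {n p : ℕ} (c : Fin n → ℝ)
    (z : Fin n → EuclideanSpace ℝ (Fin p)) (x y : EuclideanSpace ℝ (Fin p)) :
    x.ofLp ⬝ᵥ ((∑ i, c i • Matrix.vecMulVec (z i).ofLp (z i).ofLp) *ᵥ y.ofLp)
      = ∑ i, c i * ⟪z i, x⟫ * ⟪z i, y⟫ := by
  rw [sum_smul_vecMulVec_mulVec, ← EuclideanSpace.real_inner_eq_dotProduct, inner_sum]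
  refine Finset.sum_congr rfl fun i _ => ?_
  rw [inner_smul_right, real_inner_comm (z i) x]
  ring

lemma isHermitian_sum_smul_vecMulVec {n p : ℕ} (c : Fin n → ℝ)
    (z : Fin n → EuclideanSpace ℝ (Fin p)) :
    (∑ i, c i • Matrix.vecMulVec (z i).ofLp (z i).ofLp).IsHermitian := by
  ext j k
  simp only [Matrix.conjTranspose_apply, Matrix.sum_apply, Matrix.smul_apply,
    Matrix.vecMulVec_apply, smul_eq_mul, star_trivial]
  exact Finset.sum_congr rfl fun i _ => by ring

open scoped MatrixOrder in
/-- Bounds for the quadratic form of a symmetric matrix from bounds for its spectrum. -/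
lemma dotProduct_mulVec_bounds_of_spectrum {p : ℕ} {A : Matrix (Fin p) (Fin p) ℝ}
    (hA : A.IsHermitian) {a b : ℝ} (h : spectrum ℝ A ⊆ Set.Icc a b)
    (x : EuclideanSpace ℝ (Fin p)) :
    a * ‖x‖ ^ 2 ≤ x.ofLp ⬝ᵥ (A *ᵥ x.ofLp) ∧ x.ofLp ⬝ᵥ (A *ᵥ x.ofLp) ≤ b * ‖x‖ ^ 2 := by
  have hA' : IsSelfAdjoint A := hA
  have h1 : algebraMap ℝ _ a ≤ A := algebraMap_le_of_le_spectrum (fun x hx => (h hx).1) hA'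
  have h2 : A ≤ algebraMap ℝ _ b := le_algebraMap_of_spectrum_le (fun x hx => (h hx).2) hA'
  have h3 := (Matrix.le_iff.1 h1).dotProduct_mulVec_nonneg x.ofLp
  have h4 := (Matrix.le_iff.1 h2).dotProduct_mulVec_nonneg x.ofLp
  have e : ∀ t : ℝ, x.ofLp ⬝ᵥ (algebraMap ℝ (Matrix (Fin p) (Fin p) ℝ) t *ᵥ x.ofLp)
      = t * ‖x‖ ^ 2 := by
    intro t
    rw [Algebra.algebraMap_eq_smul_one, Matrix.smul_mulVec, Matrix.one_mulVec, dotProduct_smul,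
      dotProduct_self_eq_norm_sq, smul_eq_mul]
  rw [star_trivial, Matrix.sub_mulVec, dotProduct_sub, e] at h3 h4
  exact ⟨by linarith, by linarith⟩

lemma isUnit_of_dotProduct_mulVec_pos {p : ℕ} {A : Matrix (Fin p) (Fin p) ℝ}
    (h : ∀ x : EuclideanSpace ℝ (Fin p), x ≠ 0 → 0 < x.ofLp ⬝ᵥ (A *ᵥ x.ofLp)) : IsUnit A := by
  rw [← Matrix.mulVec_injective_iff_isUnit]
  intro x y hxy
  by_contra hne
  have h0 := h (WithLp.toLp 2 (x - y)) (fun h0 => hne (sub_eq_zero.1 (by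
    simpa using congrArg WithLp.ofLp h0)))
  simp only [Matrix.mulVec_sub] at h0
  rw [hxy, sub_self, dotProduct_zero] at h0
  exact lt_irrefl _ h0

open scoped MatrixOrder in
/-- For a positive definite matrix `A`, every vector is `A^{1/2} g` for some `g`. -/
lemma exists_sqrt_mulVec_eq {p : ℕ} {A : Matrix (Fin p) (Fin p) ℝ} (hA : A.IsHermitian)
    (h : ∀ x : EuclideanSpace ℝ (Fin p), x ≠ 0 → 0 < x.ofLp ⬝ᵥ (A *ᵥ x.ofLp))
    (α : EuclideanSpace ℝ (Fin p)) :
    ∃ g : EuclideanSpace ℝ (Fin p), g.ofLp ⬝ᵥ (A *ᵥ g.ofLp) = ‖α‖ ^ 2 ∧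
      ∀ x : EuclideanSpace ℝ (Fin p),
        α.ofLp ⬝ᵥ (CFC.sqrt A *ᵥ x.ofLp) = g.ofLp ⬝ᵥ (A *ᵥ x.ofLp) := by
  have hu := isUnit_of_dotProduct_mulVec_pos h
  have hpos : 0 ≤ A := by
    rw [Matrix.nonneg_iff_posSemidef]
    refine Matrix.PosSemidef.of_dotProduct_mulVec_nonneg hA fun x => ?_
    rcases eq_or_ne (WithLp.toLp 2 x : EuclideanSpace ℝ (Fin p)) 0 with h0 | h0
    · have : x = 0 := by simpa using congrArg WithLp.ofLp h0
      simp [this]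
    · simpa using (h _ h0).le
  set S := CFC.sqrt A with hS
  have hSS : S * S = A := CFC.sqrt_mul_sqrt_self A hpos
  have hSu : IsUnit S := (CFC.isUnit_sqrt_iff A hpos).2 hu
  have hSh : Sᵀ = S := by
    have : S.PosSemidef := Matrix.nonneg_iff_posSemidef.1 (CFC.sqrt_nonneg A)
    have h2 := this.isHermitian
    rwa [Matrix.IsHermitian, Matrix.conjTranspose_eq_transpose_of_trivial] at h2
  -- g = A^(-1/2) α: by symmetry of the root S, α · S x = S g · S x = g · A x.
  obtain ⟨g, hg⟩ := (Matrix.mulVec_surjective_iff_isUnit.2 hSu) α.ofLp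
  have key : ∀ x : Fin p → ℝ, α.ofLp ⬝ᵥ (S *ᵥ x) = g ⬝ᵥ (A *ᵥ x) := by
    intro x
    rw [← hg, ← hSS, ← Matrix.mulVec_mulVec, Matrix.dotProduct_mulVec g S, ← Matrix.mulVec_transpose,
      hSh]
  refine ⟨WithLp.toLp 2 g, ?_, fun x => key x.ofLp⟩
  have := key g
  simp only at hg
  rw [hg, dotProduct_self_eq_norm_sq] at this
  exact this.symm

/-! ### Design bounds and neighbourhoods in the parameter spaces -/

/-- Bounds for the design vectors `z i` at a fixed sample size `n`. -/
structure DesignBounds {n p : ℕ} (z : Fin n → EuclideanSpace ℝ (Fin p)) (c A : ℝ) : Prop where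
  lower : ∀ a, c * √(n : ℝ) ^ 2 * ‖a‖ ^ 2 ≤ ∑ i, ⟪z i, a⟫ ^ 2
  upper : ∀ a, ∑ i, ⟪z i, a⟫ ^ 2 ≤ (A * √(n : ℝ) * ‖a‖) ^ 2
  fourth : ∀ a, ∑ i, ⟪z i, a⟫ ^ 4 ≤ (A * √(n : ℝ) * ‖a‖ ^ 2) ^ 2
  norm_le : ∀ i, ‖z i‖ ≤ A * √(p : ℝ)

lemma exists_eventually_designBounds {p : ℕ → ℕ} {z : ∀ n, Fin n → EuclideanSpace ℝ (Fin (p n))}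
    (hEig : DesignEigenvalueBounds z) (hMom : DesignMomentBounds z) :
    ∃ c A : ℝ, 0 < c ∧ 0 ≤ A ∧ ∀ᶠ n in atTop, DesignBounds (z n) c A := by
  obtain ⟨c, C, hc, h1⟩ := hEig
  obtain ⟨⟨Cz, h2⟩, C4, h3⟩ := hMom
  -- A single constant whose square dominates all the given ones; the 1 ensures A ≤ A².
  set A : ℝ := 1 + |C| + |Cz| + |C4| with hA
  have hA1 : 1 ≤ A := by rw [hA]; linarith [abs_nonneg C, abs_nonneg Cz, abs_nonneg C4]
  have hAsq : A ≤ A ^ 2 := by nlinarith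
  have hC : C ≤ A ^ 2 := by
    linarith [le_abs_self C, abs_nonneg Cz, abs_nonneg C4]
  have hCz : Cz ≤ A ^ 2 := by
    linarith [le_abs_self Cz, abs_nonneg C, abs_nonneg C4]
  have hC4 : C4 ≤ A ^ 2 := by
    linarith [le_abs_self C4, abs_nonneg C, abs_nonneg Cz]
  refine ⟨c, A, hc, by linarith, ?_⟩
  filter_upwards [h1, h2, h3, eventually_gt_atTop 0] with n h1 h2 h3 hn
  have hn' : (0 : ℝ) < n := by exact_mod_cast hn
  have hsq : √(n : ℝ) ^ 2 = n := Real.sq_sqrt hn'.le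
  have hq : ∀ a : EuclideanSpace ℝ (Fin (p n)),
      c * n * ‖a‖ ^ 2 ≤ ∑ i, ⟪z n i, a⟫ ^ 2 ∧ ∑ i, ⟪z n i, a⟫ ^ 2 ≤ C * n * ‖a‖ ^ 2 := by
    intro a
    have hh : ((n : ℝ)⁻¹ • ∑ i, Matrix.vecMulVec (z n i).ofLp (z n i).ofLp)
        = ∑ i, (n : ℝ)⁻¹ • Matrix.vecMulVec (z n i).ofLp (z n i).ofLp := Finset.smul_sum
    rw [hh] at h1
    have h4 := dotProduct_mulVec_bounds_of_spectrum (isHermitian_sum_smul_vecMulVec _ _) h1 a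
    rw [dotProduct_sum_smul_vecMulVec_mulVec] at h4
    have h5 : ∑ i, (n : ℝ)⁻¹ * ⟪z n i, a⟫ * ⟪z n i, a⟫ = (n : ℝ)⁻¹ * ∑ i, ⟪z n i, a⟫ ^ 2 := by
      rw [Finset.mul_sum]; exact Finset.sum_congr rfl fun i _ => by ring
    rw [h5, inv_mul_eq_div, le_div_iff₀ hn', div_le_iff₀ hn'] at h4
    exact ⟨by linarith [h4.1], by linarith [h4.2]⟩
  constructor
  · intro a
    rw [hsq]; exact (hq a).1
  · intro a
    rw [mul_pow, mul_pow, hsq]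
    refine (hq a).2.trans ?_
    gcongr
  · intro a
    rcases eq_or_ne a 0 with rfl | ha
    · simp
    have ha' : 0 < ‖a‖ := norm_pos_iff.2 ha
    have h4 := h3 (‖a‖⁻¹ • a) (by rw [norm_smul, norm_inv, norm_norm, inv_mul_cancel₀ ha'.ne'])
    have h5 : ∑ i, |⟪‖a‖⁻¹ • a, z n i⟫| ^ 4 = (‖a‖ ^ 4)⁻¹ * ∑ i, ⟪z n i, a⟫ ^ 4 := by
      rw [Finset.mul_sum]
      refine Finset.sum_congr rfl fun i _ => ?_
      rw [inner_smul_left, RCLike.conj_to_real, real_inner_comm, abs_mul, mul_pow,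
        abs_of_pos (inv_pos.2 ha'), inv_pow, Even.pow_abs (by decide)]
    rw [h5, inv_mul_eq_div, div_le_iff₀ (by positivity)] at h4
    refine h4.trans ?_
    rw [mul_pow, mul_pow, hsq, ← pow_mul]
    gcongr
  · intro i
    refine abs_le_of_sq_le_sq' ?_ (by positivity) |>.2
    rw [mul_pow, Real.sq_sqrt (Nat.cast_nonneg _)]
    exact (h2 i).trans (mul_le_mul_of_nonneg_right hCz (Nat.cast_nonneg _))

namespace GLM

/-- Sequences within `O(√(p n / n))` of the true parameter stay in the parameter spaces. -/
lemma ParameterSpaces.eventually_mem {M : GLM} {p : ℕ → ℕ}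
    {z : ∀ n, Fin n → EuclideanSpace ℝ (Fin (p n))} {β₀ : ∀ n, EuclideanSpace ℝ (Fin (p n))}
    {B : ∀ n, Set (EuclideanSpace ℝ (Fin (p n)))} (hPar : M.ParameterSpaces z β₀ B) (K : ℝ) :
    ∀ᶠ n in atTop, ∀ δ : EuclideanSpace ℝ (Fin (p n)), ‖δ‖ ≤ K * √((p n : ℝ) / n) →
      β₀ n + δ ∈ B n := by
  -- With this constant a perturbation of size K √(p/n) covers at most half of the distance to the
  -- boundary, and that distance is positive since the true value is interior.
  have h := hPar.dist_boundary.bound (c := (2 * (|K| + 1))⁻¹) (by positivity)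
  filter_upwards [h] with n hn δ hδ
  by_contra hmem
  have h1 : Metric.infDist (β₀ n) (B n)ᶜ ≤ ‖δ‖ := by
    refine (Metric.infDist_le_dist_of_mem (y := β₀ n + δ) hmem).trans (le_of_eq ?_)
    simp
  have h2 : 0 < Metric.infDist (β₀ n) (B n)ᶜ := by
    rw [← Metric.infDist_closure, ← (isClosed_closure).notMem_iff_infDist_pos ⟨_, subset_closure hmem⟩,
      closure_compl]
    exact fun h => h (hPar.interior n)
  rw [Real.norm_of_nonneg (Real.sqrt_nonneg _), Real.norm_of_nonneg h2.le, inv_mul_eq_div,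
    le_div_iff₀ (by positivity)] at hn
  have h3 : K * √((p n : ℝ) / n) ≤ |K| * √((p n : ℝ) / n) :=
    mul_le_mul_of_nonneg_right (le_abs_self K) (Real.sqrt_nonneg _)
  have h4 := Real.sqrt_nonneg ((p n : ℝ) / n)
  have h5 : 0 ≤ |K| * √((p n : ℝ) / n) := by positivity
  nlinarith

/-! ### Moments of the errors and of their weighted sums -/

section Response

variable {M : GLM} {Ω : Type*} [MeasurableSpace Ω] {P : Measure Ω} {Y : Ω → ℝ} {η : ℝ}
  (hY : Measurable Y) (hmap : P.map Y = M.law (M.u η)) (hη : η ∈ M.D)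
include hY hmap hη

lemma memLp_error [IsProbabilityMeasure P] : MemLp (fun ω => Y ω - M.h η) 2 P := by
  have h1 := M.memLp_id_law (M.u_mem hη)
  rw [← hmap, memLp_map_measure_iff (by fun_prop) hY.aemeasurable] at h1
  exact h1.sub (memLp_const _)

lemma integral_response : ∫ ω, Y ω ∂P = M.h η := by
  have h1 := M.integral_id_law (M.u_mem hη)
  rwa [← hmap, integral_map hY.aemeasurable (by fun_prop), M.deriv_b_u hη] at h1

lemma integral_error [IsProbabilityMeasure P] : ∫ ω, (Y ω - M.h η) ∂P = 0 := by
  have h1 := M.memLp_id_law (M.u_mem hη)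
  rw [← hmap, memLp_map_measure_iff (by fun_prop) hY.aemeasurable] at h1
  have h2 : Integrable Y P := h1.integrable (by norm_num)
  rw [integral_sub h2 (integrable_const _), integral_response hY hmap hη]
  simp

lemma integral_error_sq : ∫ ω, (Y ω - M.h η) ^ 2 ∂P = M.v η := by
  have h1 := M.variance_law (M.u_mem hη)
  rw [variance_eq_integral (by fun_prop)] at h1
  simp only [id] at h1
  rw [M.integral_id_law (M.u_mem hη), M.deriv_b_u hη, ← hmap,
    integral_map hY.aemeasurable (by fun_prop)] at h1
  exact h1

omit hη in
lemma mgf_mul_error {a t : ℝ} (hΘ : M.u η + M.φ * (t * a) ∈ M.Θ) :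
    mgf (fun ω => a * (Y ω - M.h η)) P t =
      Real.exp ((M.b (M.u η + M.φ * (t * a)) - M.b (M.u η)) / M.φ - t * a * M.h η) := by
  have h1 := M.mgf_law hΘ
  rw [← hmap, mgf_id_map hY.aemeasurable] at h1
  rw [mgf_const_mul, show (fun ω => Y ω - M.h η) = fun ω => Y ω + -M.h η from
    funext fun ω => sub_eq_add_neg _ _, mgf_add_const, mul_comm a t, h1, ← Real.exp_add]
  congr 1
  ring

end Response

end GLM

/-- The second moment of a sum of independent centered random multiples of fixed vectors. -/
lemma integral_norm_sum_smul_sq {ι Ω E : Type*} [Fintype ι] [MeasurableSpace Ω] {P : Measure Ω}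
    [IsProbabilityMeasure P] [NormedAddCommGroup E] [InnerProductSpace ℝ E] {e : ι → Ω → ℝ}
    (hL : ∀ i, MemLp (e i) 2 P) (hind : Pairwise fun i j => IndepFun (e i) (e j) P)
    (h0 : ∀ i, ∫ ω, e i ω ∂P = 0) (c : ι → ℝ) (z : ι → E) :
    Integrable (fun ω => ‖∑ i, (c i * e i ω) • z i‖ ^ 2) P ∧
    ∫ ω, ‖∑ i, (c i * e i ω) • z i‖ ^ 2 ∂P = ∑ i, c i ^ 2 * ‖z i‖ ^ 2 * ∫ ω, e i ω ^ 2 ∂P := by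
  have hexp : (fun ω => ‖∑ i, (c i * e i ω) • z i‖ ^ 2) =
      fun ω => ∑ i, ∑ j, c i * c j * ⟪z i, z j⟫ * (e i ω * e j ω) := by
    ext ω
    rw [← real_inner_self_eq_norm_sq, sum_inner]
    refine Finset.sum_congr rfl fun i _ => ?_
    rw [inner_sum]
    refine Finset.sum_congr rfl fun j _ => ?_
    rw [inner_smul_left, inner_smul_right, RCLike.conj_to_real]
    ring
  have hint : ∀ i j, Integrable (fun ω => c i * c j * ⟪z i, z j⟫ * (e i ω * e j ω)) P :=
    fun i j => ((hL i).integrable_mul (hL j)).const_mul _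
  rw [hexp]
  refine ⟨integrable_finsetSum _ fun i _ => integrable_finsetSum _ fun j _ => hint i j, ?_⟩
  rw [integral_finsetSum _ fun i _ => integrable_finsetSum _ fun j _ => hint i j]
  refine Finset.sum_congr rfl fun i _ => ?_
  rw [integral_finsetSum _ fun j _ => hint i j, Finset.sum_eq_single i]
  · rw [integral_const_mul, real_inner_self_eq_norm_sq]
    simp only [← sq]
  · intro j _ hj
    rw [integral_const_mul, (hind hj.symm).integral_fun_mul_eq_mul_integral
      (hL i).aestronglyMeasurable (hL j).aestronglyMeasurable, h0 i]
    simp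
  · simp

/-- Markov's inequality for nonnegative random variables with a bounded mean. -/
lemma measureReal_lt_le_div {Ω : Type*} [MeasurableSpace Ω] {P : Measure Ω}
    [IsProbabilityMeasure P] {X : Ω → ℝ} (hX : Integrable X P) (h0 : ∀ ω, 0 ≤ X ω) {m k : ℝ}
    (hm : ∫ ω, X ω ∂P ≤ m) (hk : 0 < k) : P.real {ω | k < X ω} ≤ m / k := by
  rw [le_div_iff₀ hk, mul_comm]
  calc _ ≤ k * P.real {ω | k ≤ X ω} := by
        refine mul_le_mul_of_nonneg_left (measureReal_mono ?_) hk.le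
        exact fun ω (hω : k < X ω) => show k ≤ X ω from hω.le
    _ ≤ _ := (mul_meas_ge_le_integral_of_nonneg (ae_of_all _ h0) hX k).trans hm

/-! ### Central limit theorem for the score -/

namespace GLM

/-- Asymptotic normality of the score in directions in which it has variance one. -/
theorem tendstoInDistribution_score {M : GLM} {p : ℕ → ℕ}
    {z : ∀ n, Fin n → EuclideanSpace ℝ (Fin (p n))} {β₀ : ∀ n, EuclideanSpace ℝ (Fin (p n))}
    {Ω : ℕ → Type*} [∀ n, MeasurableSpace (Ω n)] {P : ∀ n, Measure (Ω n)}
    [∀ n, IsProbabilityMeasure (P n)] {y : ∀ n, Fin n → Ω n → ℝ} (hy : M.IsSample z β₀ P y)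
    (hu : ContDiffOn ℝ 3 M.u M.D) (hw : ContDiffOn ℝ 1 M.w M.D) {A C c c₀ κ : ℝ} (hA : 0 ≤ A)
    (hC : 0 ≤ C) (hc₀ : 0 < c₀) (hκ : 0 ≤ κ)
    (hz : ∀ᶠ n in atTop, DesignBounds (z n) c A)
    (hB : ∀ K : ℝ, ∀ᶠ n in atTop, ∀ δ : EuclideanSpace ℝ (Fin (p n)),
      ‖δ‖ ≤ K * √((p n : ℝ) / n) → ∀ i, M.BoundedAt C ⟪z n i, β₀ n + δ⟫)
    (hlow : ∀ᶠ n in atTop, ∀ i, c₀ ≤ |deriv M.u ⟪z n i, β₀ n⟫|)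
    (hr : Tendsto (fun n : ℕ => √((p n : ℝ) / n)) atTop (𝓝 0)) (hp : ∀ᶠ n in atTop, 1 ≤ p n)
    {g : ∀ n, EuclideanSpace ℝ (Fin (p n))} (hg : ∀ᶠ n : ℕ in atTop, √(n : ℝ) * ‖g n‖ ≤ κ)
    (hg1 : ∀ᶠ n in atTop, ∑ i, M.w ⟪z n i, β₀ n⟫ * ⟪z n i, g n⟫ ^ 2 = 1) :
    TendstoInDistribution (fun n ω => M.φ⁻¹ * ∑ i, deriv M.u ⟪z n i, β₀ n⟫ * ⟪z n i, g n⟫ *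
      (y n i ω - M.h ⟪z n i, β₀ n⟫)) atTop (id : ℝ → ℝ) P (gaussianReal 0 1) := by
  have hφ := M.φ_pos
  set T : ∀ n, Ω n → ℝ := fun n ω => M.φ⁻¹ * ∑ i, deriv M.u ⟪z n i, β₀ n⟫ * ⟪z n i, g n⟫ *
      (y n i ω - M.h ⟪z n i, β₀ n⟫) with hT
  have hTm : ∀ n, Measurable (T n) := fun n => by
    have := hy.measurable n
    fun_prop
  refine ⟨fun n => (hTm n).aemeasurable, by fun_prop, ?_⟩
  have hlim : (⟨(gaussianReal 0 1).map id, Measure.isProbabilityMeasure_map (by fun_prop)⟩ :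
      ProbabilityMeasure ℝ) = ⟨gaussianReal 0 1, inferInstance⟩ :=
    Subtype.ext (by simp)
  rw [hlim]
  refine tendsto_gaussianReal_of_tendsto_mgf fun t => ?_
  simp only [ProbabilityMeasure.coe_mk, mgf_id_map (hTm _).aemeasurable]
  -- The tilt of the i-th canonical parameter is t u'(η_i) ζ_i, of size at most |t| C |ζ_i|.
  -- Expanding the cumulant function on radius Q |ζ_i| allows tilts up to Q |ζ_i| c₀ / 2, which is
  -- this bound.
  set Q : ℝ := 2 * |t| * C / c₀ with hQ
  have hQ0 : 0 ≤ Q := by positivity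
  set r : ℕ → ℝ := fun n => √((p n : ℝ) / n) with hrdef
  set V : ℝ := 12 * M.φ ^ 2 * C ^ 3 / c₀ ^ 4 * (Q * A * κ) with hV
  set D : ℝ := t ^ 2 * (M.φ⁻¹ ^ 2 * C ^ 2 * A ^ 2 * κ ^ 2) * V with hD
  have hsmall : ∀ᶠ n in atTop, C * (Q * A * κ * r n) ≤ c₀ / 2 := by
    have : Tendsto (fun n => C * (Q * A * κ * r n)) atTop (𝓝 (C * (Q * A * κ * 0))) :=
      (hr.const_mul _).const_mul _
    rw [mul_zero, mul_zero] at this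
    exact this.eventually_le_const (by positivity)
  have hmain : ∀ᶠ n in atTop, ∃ k : ℝ, mgf (T n) (P n) t = Real.exp k ∧
      |k - t ^ 2 / 2| ≤ D * r n := by
    filter_upwards [hz, hB (Q * κ), hlow, hp, hg, hg1, hsmall, eventually_gt_atTop 0] with
      n hz hB hlow hp hg hg1 hsmall hn
    have hn' : (0 : ℝ) < n := by exact_mod_cast hn
    have hsn : 0 < √(n : ℝ) := Real.sqrt_pos.2 hn'
    have hp' : (1 : ℝ) ≤ √(p n : ℝ) := Real.one_le_sqrt.2 (by exact_mod_cast hp)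
    have hrn : r n = √(p n : ℝ) / √(n : ℝ) := Real.sqrt_div (Nat.cast_nonneg _) _
    have hgn : ‖g n‖ ≤ κ / √(n : ℝ) := by rw [le_div_iff₀ hsn]; linarith
    have hgr : ‖g n‖ ≤ κ * r n := by
      rw [hrn]
      refine hgn.trans ?_
      rw [mul_div_assoc']
      gcongr
      nlinarith
    have hzg : ∀ i, |⟪z n i, g n⟫| ≤ A * κ * r n := fun i => by
      calc _ ≤ ‖z n i‖ * ‖g n‖ := abs_real_inner_le_norm _ _
        _ ≤ (A * √(p n : ℝ)) * (κ / √(n : ℝ)) := by gcongr; exact hz.norm_le i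
        _ = _ := by rw [hrn]; ring
    set η : Fin n → ℝ := fun i => ⟪z n i, β₀ n⟫ with hη
    set ζ : Fin n → ℝ := fun i => ⟪z n i, g n⟫ with hζ
    -- Every s in the interval is the linear predictor at β₀ + λ g with |λ| ≤ Q, a point within
    -- O(√(p/n)) of β₀. If ζ_i = 0, the interval is a single point and the division by zero returns
    -- λ = 0.
    have hIcc : ∀ i, ∀ s ∈ Set.Icc (η i - Q * |ζ i|) (η i + Q * |ζ i|), M.BoundedAt C s := by
      intro i s hs
      have h1 : |s - η i| ≤ Q * |ζ i| := abs_le.2 ⟨by linarith [hs.1], by linarith [hs.2]⟩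
      have h2 : |(s - η i) / ζ i| ≤ Q := by
        rw [abs_div]
        exact div_le_of_le_mul₀ (abs_nonneg _) hQ0 h1
      have h3 := hB (((s - η i) / ζ i) • g n) (by
        rw [norm_smul, Real.norm_eq_abs, mul_assoc]
        exact mul_le_mul h2 hgr (norm_nonneg _) hQ0) i
      have h4 : ⟪z n i, β₀ n + ((s - η i) / ζ i) • g n⟫ = s := by
        rw [inner_add_right, inner_smul_right]
        change η i + (s - η i) / ζ i * ζ i = s
        rcases eq_or_ne (ζ i) 0 with h0 | h0
        · rw [h0, abs_zero, mul_zero] at h1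
          have := abs_nonpos_iff.1 h1
          rw [h0, mul_zero]; linarith
        · field_simp
          ring
      rwa [h4] at h3
    have hρ : ∀ i, 0 ≤ Q * |ζ i| := fun i => by positivity
    have hρ' : ∀ i, Q * |ζ i| ≤ Q * A * κ * r n := fun i => by
      calc _ ≤ Q * (A * κ * r n) := mul_le_mul_of_nonneg_left (hzg i) hQ0
        _ = _ := by ring
    have hBη : ∀ i, M.BoundedAt C (η i) := fun i =>
      hIcc i _ ⟨by linarith [hρ i], by linarith [hρ i]⟩
    set a : Fin n → ℝ := fun i => M.φ⁻¹ * (deriv M.u (η i) * ζ i) with ha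
    have hcum := fun i => abs_cumulant_sub_le hu hw (hρ i) (hIcc i) hc₀ (hlow i)
      ((mul_le_mul_of_nonneg_left (hρ' i) hC).trans hsmall) (τ := M.φ * (t * a i)) (by
        have e : M.φ * (t * a i) = t * (deriv M.u (η i) * ζ i) := by
          rw [ha]; field_simp
        rw [e, abs_mul, abs_mul, hQ]
        have := (hBη i).deriv_u
        calc |t| * (|deriv M.u (η i)| * |ζ i|) ≤ |t| * (C * |ζ i|) := by gcongr
          _ = _ := by field_simp)
    have hTsum : T n = ∑ i, fun ω => a i * (y n i ω - M.h (η i)) := by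
      ext ω
      rw [Finset.sum_apply, hT]
      simp only [Finset.mul_sum]
      exact Finset.sum_congr rfl fun i _ => by rw [ha]; ring
    have hind : iIndepFun (fun i ω => a i * (y n i ω - M.h (η i))) (P n) :=
      (hy.indep n).comp (fun i x => a i * (x - M.h (η i))) fun i => by fun_prop
    refine ⟨∑ i, ((M.b (M.u (η i) + M.φ * (t * a i)) - M.b (M.u (η i))) / M.φ
      - t * a i * M.h (η i)), ?_, ?_⟩
    · rw [hTsum, hind.mgf_sum (fun i => by have := hy.measurable n i; fun_prop), Real.exp_sum]
      exact Finset.prod_congr rfl fun i _ =>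
        mgf_mul_error (hy.measurable n i) (hy.map_eq n i) (hcum i).1
    -- a_i² v(η_i) = w(η_i) ζ_i², so the variances add up to the normalized quadratic form.
    · have hvar : ∑ i, (t * a i) ^ 2 * M.v (η i) / 2 = t ^ 2 / 2 := by
        have : ∀ i, (t * a i) ^ 2 * M.v (η i) / 2 = t ^ 2 / 2 * (M.w (η i) * ζ i ^ 2) := by
          intro i
          rw [w_eq hu (hBη i).mem, ha]; ring
        rw [Finset.sum_congr rfl fun i _ => this i, ← Finset.mul_sum, hg1, mul_one]
      rw [← hvar, ← Finset.sum_sub_distrib]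
      refine (Finset.abs_sum_le_sum_abs _ _).trans ?_
      calc _ ≤ ∑ i, t ^ 2 * (M.φ⁻¹ ^ 2 * C ^ 2) * (V * r n) * ζ i ^ 2 := by
            refine Finset.sum_le_sum fun i _ => ?_
            have h1 := (hcum i).2
            rw [mul_div_cancel_left₀ _ hφ.ne'] at h1
            refine h1.trans ?_
            have h2 : (t * a i) ^ 2 ≤ t ^ 2 * (M.φ⁻¹ ^ 2 * C ^ 2) * ζ i ^ 2 := by
              have h3 : deriv M.u (η i) ^ 2 ≤ C ^ 2 := by
                rw [← sq_abs]; have := (hBη i).deriv_u; gcongr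
              calc (t * a i) ^ 2 = t ^ 2 * (M.φ⁻¹ ^ 2 * deriv M.u (η i) ^ 2) * ζ i ^ 2 := by
                    rw [ha]; ring
                _ ≤ _ := by gcongr
            have h4 : 12 * M.φ ^ 2 * C ^ 3 / c₀ ^ 4 * (Q * |ζ i|) ≤ V * r n := by
              rw [hV, mul_assoc _ (Q * A * κ)]
              exact mul_le_mul_of_nonneg_left (hρ' i) (by positivity)
            calc _ ≤ (t ^ 2 * (M.φ⁻¹ ^ 2 * C ^ 2) * ζ i ^ 2) * (V * r n) := by gcongr
              _ = _ := by ring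
        _ = t ^ 2 * (M.φ⁻¹ ^ 2 * C ^ 2) * (V * r n) * ∑ i, ζ i ^ 2 := by rw [Finset.mul_sum]
        _ ≤ t ^ 2 * (M.φ⁻¹ ^ 2 * C ^ 2) * (V * r n) * (A * κ) ^ 2 := by
            have h5 : ∑ i, ζ i ^ 2 ≤ (A * κ) ^ 2 := by
              refine (hz.upper (g n)).trans ?_
              rw [mul_assoc]
              gcongr
            have h6 : 0 ≤ V := by positivity
            have h7 : 0 ≤ r n := Real.sqrt_nonneg _
            gcongr
        _ = D * r n := by rw [hD]; ring
  have hlog : Tendsto (fun n => Real.log (mgf (T n) (P n) t)) atTop (𝓝 (t ^ 2 / 2)) := by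
    rw [tendsto_iff_dist_tendsto_zero]
    have h1 : Tendsto (fun n => D * r n) atTop (𝓝 0) := by simpa using hr.const_mul D
    refine squeeze_zero' (Eventually.of_forall fun _ => dist_nonneg) ?_ h1
    filter_upwards [hmain] with n hn
    obtain ⟨k, h2, h3⟩ := hn
    rw [h2, Real.log_exp, Real.dist_eq]
    exact h3
  refine ((Real.continuous_exp.tendsto _).comp hlog).congr' ?_
  filter_upwards [hmain] with n hn
  obtain ⟨k, h2, -⟩ := hn
  simp only [Function.comp]
  rw [h2, Real.log_exp]

end GLM

/-! ### Probability bounds and rates of convergence -/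

/-- Only subadditivity is used, so the events need not be measurable. -/
lemma tendsto_measure_one_of_compl_le {Ω : ℕ → Type*} [∀ n, MeasurableSpace (Ω n)]
    {P : ∀ n, Measure (Ω n)} [∀ n, IsProbabilityMeasure (P n)] {s : ∀ n, Set (Ω n)}
    (h : ∀ ε : ℝ, 0 < ε → ∀ᶠ n in atTop, P n (s n)ᶜ ≤ ENNReal.ofReal ε) :
    Tendsto (fun n => P n (s n)) atTop (𝓝 1) := by
  have h0 : Tendsto (fun n => P n (s n)ᶜ) atTop (𝓝 0) := by
    rw [ENNReal.tendsto_nhds_zero]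
    intro ε hε
    rcases eq_or_ne ε ⊤ with rfl | hε'
    · exact Eventually.of_forall fun _ => le_top
    · filter_upwards [h ε.toReal (ENNReal.toReal_pos hε.ne' hε')] with n hn
      rwa [ENNReal.ofReal_toReal hε'] at hn
  have h1 : Tendsto (fun n => 1 - P n (s n)ᶜ) atTop (𝓝 (1 - 0)) :=
    ENNReal.Tendsto.sub tendsto_const_nhds h0 (Or.inl ENNReal.one_ne_top)
  rw [tsub_zero] at h1
  refine tendsto_of_tendsto_of_tendsto_of_le_of_le h1 tendsto_const_nhds (fun n => ?_)
    fun n => prob_le_one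
  rw [tsub_le_iff_right]
  calc 1 = P n Set.univ := measure_univ.symm
    _ = P n (s n ∪ (s n)ᶜ) := by rw [Set.union_compl_self]
    _ ≤ _ := measure_union_le _ _

/-- A tail bound for a sum of independent centered random multiples of fixed vectors. -/
lemma measureReal_lt_norm_sum_smul_le {ι Ω E : Type*} [Fintype ι] [MeasurableSpace Ω]
    {P : Measure Ω} [IsProbabilityMeasure P] [NormedAddCommGroup E] [InnerProductSpace ℝ E]
    {e : ι → Ω → ℝ} (hL : ∀ i, MemLp (e i) 2 P)
    (hind : Pairwise fun i j => IndepFun (e i) (e j) P) (h0 : ∀ i, ∫ ω, e i ω ∂P = 0)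
    (c : ι → ℝ) (z : ι → E) {Γ m K : ℝ} (hm : 0 < m) (hK : 0 < K)
    (hΓ : ∑ i, c i ^ 2 * ‖z i‖ ^ 2 * ∫ ω, e i ω ^ 2 ∂P ≤ Γ * m ^ 2) :
    P.real {ω | K * m < ‖∑ i, (c i * e i ω) • z i‖} ≤ Γ / K ^ 2 := by
  obtain ⟨h1, h2⟩ := integral_norm_sum_smul_sq hL hind h0 c z
  have h3 := measureReal_lt_le_div h1 (fun _ => by positivity) (h2.le.trans hΓ)
    (k := (K * m) ^ 2) (by positivity)
  have h4 : Γ * m ^ 2 / (K * m) ^ 2 = Γ / K ^ 2 := by field_simp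
  rw [h4] at h3
  refine (measureReal_mono fun ω (hω : K * m < _) => ?_).trans h3
  exact pow_lt_pow_left₀ hω (by positivity) (by norm_num)

lemma measureReal_lt_sum_sq_le {ι Ω : Type*} [Fintype ι] [MeasurableSpace Ω]
    {P : Measure Ω} [IsProbabilityMeasure P] {e : ι → Ω → ℝ} (hL : ∀ i, MemLp (e i) 2 P)
    (c : ι → ℝ) {Γ m K : ℝ} (hm : 0 < m) (hK : 0 < K)
    (hΓ : ∑ i, c i ^ 2 * ∫ ω, e i ω ^ 2 ∂P ≤ Γ * m ^ 2) :
    P.real {ω | (K * m) ^ 2 < ∑ i, (c i * e i ω) ^ 2} ≤ Γ / K ^ 2 := by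
  have hint : ∀ i, Integrable (fun ω => (c i * e i ω) ^ 2) P := fun i => by
    simp only [mul_pow]; exact (hL i).integrable_sq.const_mul _
  have h2 : ∫ ω, ∑ i, (c i * e i ω) ^ 2 ∂P ≤ Γ * m ^ 2 := by
    rw [integral_finsetSum _ fun i _ => hint i]
    refine le_trans (le_of_eq (Finset.sum_congr rfl fun i _ => ?_)) hΓ
    simp only [mul_pow]
    rw [integral_const_mul]
  have h3 := measureReal_lt_le_div (integrable_finsetSum _ fun i _ => hint i)
    (fun _ => Finset.sum_nonneg fun i _ => sq_nonneg _) h2 (k := (K * m) ^ 2) (by positivity)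
  have h4 : Γ * m ^ 2 / (K * m) ^ 2 = Γ / K ^ 2 := by field_simp
  rwa [h4] at h3

namespace GLM

variable {M : GLM} {p : ℕ → ℕ} {z : ∀ n, Fin n → EuclideanSpace ℝ (Fin (p n))}
  {β₀ : ∀ n, EuclideanSpace ℝ (Fin (p n))}

/-- C does not depend on K: for each K the whole ball of radius K √(p/n) eventually lies in the
parameter space, where the regularity bounds hold. Only the onset depends on K. -/
lemma exists_eventually_boundedAt {B : ∀ n, Set (EuclideanSpace ℝ (Fin (p n)))}
    (hPar : M.ParameterSpaces z β₀ B) (hReg : M.Regular z β₀ B) :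
    ∃ C : ℝ, 0 ≤ C ∧ ∀ K : ℝ, ∀ᶠ n in atTop, ∀ δ : EuclideanSpace ℝ (Fin (p n)),
      ‖δ‖ ≤ K * √((p n : ℝ) / n) → ∀ i, M.BoundedAt C ⟪z n i, β₀ n + δ⟫ := by
  obtain ⟨C, hC⟩ := hReg.bounded
  refine ⟨|C|, abs_nonneg C, fun K => ?_⟩
  filter_upwards [hC, hPar.eventually_mem K] with n h1 h2 δ hδ i
  obtain ⟨-, h3, h4, h5, h6, h7, h8⟩ := h1 i _ (h2 δ hδ)
  have hC' := le_abs_self C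
  exact ⟨hPar.admissible n i _ (h2 δ hδ), h3.trans hC', h4.trans hC', h5.trans hC', h6.trans hC',
    h7.trans hC', h8.trans hC'⟩

/-- The interval between two predictors is the image of the segment from β to β + δ, so bounds on a
ball of parameters suffice for Taylor expansion. -/
lemma boundedAt_of_mem_uIcc {E : Type*} [NormedAddCommGroup E] [InnerProductSpace ℝ E]
    {C R : ℝ} {x β : E} (h : ∀ δ : E, ‖δ‖ ≤ R → M.BoundedAt C ⟪x, β + δ⟫) {δ : E} (hδ : ‖δ‖ ≤ R) :
    ∀ s ∈ Set.uIcc ⟪x, β⟫ ⟪x, β + δ⟫, M.BoundedAt C s := by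
  intro s hs
  rw [← segment_eq_uIcc, segment_eq_image'] at hs
  obtain ⟨t, ⟨ht0, ht1⟩, rfl⟩ := hs
  have h1 := h (t • δ) (by
    rw [norm_smul, Real.norm_of_nonneg ht0]
    exact (mul_le_of_le_one_left (norm_nonneg _) ht1).trans hδ)
  rw [inner_add_right, inner_smul_right] at h1
  simp only [inner_add_right, add_sub_cancel_left, smul_eq_mul]
  exact h1

lemma dotProduct_fisher_mulVec {n p : ℕ} (z : Fin n → EuclideanSpace ℝ (Fin p))
    (β x y : EuclideanSpace ℝ (Fin p)) :
    x.ofLp ⬝ᵥ (M.fisher z β *ᵥ y.ofLp) = ∑ i, M.w ⟪z i, β⟫ * ⟪z i, x⟫ * ⟪z i, y⟫ :=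
  dotProduct_sum_smul_vecMulVec_mulVec _ _ _ _

lemma SolvesScoring.sum_smul_eq {n p : ℕ} {z : Fin n → EuclideanSpace ℝ (Fin p)} {y : Fin n → ℝ}
    {β β₁ : EuclideanSpace ℝ (Fin p)} (h : M.SolvesScoring z y β β₁) :
    ∑ i, (M.w ⟪z i, β⟫ * ⟪z i, β₁ - β⟫) • z i
      = M.φ⁻¹ • ∑ i, (deriv M.u ⟪z i, β⟫ * (y i - M.h ⟪z i, β⟫)) • z i := by
  rw [SolvesScoring, fisher, sum_smul_vecMulVec_mulVec] at h
  exact WithLp.ofLp_injective 2 h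

lemma solvesScoring_oneStep {n p : ℕ} {z : Fin n → EuclideanSpace ℝ (Fin p)} {y : Fin n → ℝ}
    {β : EuclideanSpace ℝ (Fin p)} (h : IsUnit (M.fisher z β)) :
    M.SolvesScoring z y β (M.oneStep z y β) := by
  rw [SolvesScoring, oneStep, add_sub_cancel_left, Matrix.mulVec_mulVec,
    Matrix.mul_nonsing_inv _ ((Matrix.isUnit_iff_isUnit_det _).1 h), Matrix.one_mulVec]

section Rates

variable (hu : ContDiffOn ℝ 3 M.u M.D) (hw : ContDiffOn ℝ 1 M.w M.D) {A C c W : ℝ} (hA : 0 ≤ A)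
  (hC : 0 ≤ C) (hc : 0 < c) (hW : 0 < W)
  (hz : ∀ᶠ n in atTop, DesignBounds (z n) c A)
  (hB : ∀ K : ℝ, ∀ᶠ n in atTop, ∀ δ : EuclideanSpace ℝ (Fin (p n)),
    ‖δ‖ ≤ K * √((p n : ℝ) / n) → ∀ i, M.BoundedAt C ⟪z n i, β₀ n + δ⟫)
  (hwW : ∀ᶠ n in atTop, ∀ i, W ≤ M.w ⟪z n i, β₀ n⟫)
  (hr : Tendsto (fun n : ℕ => √((p n : ℝ) / n)) atTop (𝓝 0))
include hw hA hC hc hW hz hB hwW hr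

/-- Near the true parameter, the Fisher information is of order at least `n`. -/
lemma eventually_le_fisher (K : ℝ) :
    ∀ᶠ n : ℕ in atTop, ∀ β : EuclideanSpace ℝ (Fin (p n)), ‖β - β₀ n‖ ≤ K * √((p n : ℝ) / n) →
      ∀ x : EuclideanSpace ℝ (Fin (p n)), c * W / 2 * √(n : ℝ) ^ 2 * ‖x‖ ^ 2 ≤
        x.ofLp ⬝ᵥ (M.fisher (z n) β *ᵥ x.ofLp) := by
  have hsmall : ∀ᶠ n : ℕ in atTop, C * A ^ 2 * (K * √((p n : ℝ) / n)) ≤ c * W / 2 := by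
    have : Tendsto (fun n : ℕ => C * A ^ 2 * (K * √((p n : ℝ) / n))) atTop (𝓝 0) := by
      simpa using (hr.const_mul K).const_mul (C * A ^ 2)
    exact this.eventually_le_const (by positivity)
  filter_upwards [hz, hB K, hwW, hsmall, eventually_gt_atTop 0] with n hz hB hwW hsmall hn β hβ x
  have hsn : 0 < √(n : ℝ) := Real.sqrt_pos.2 (by exact_mod_cast hn)
  have hseg := fun i => boundedAt_of_mem_uIcc (fun δ hδ => hB δ hδ i) hβ
  simp only [add_sub_cancel] at hseg
  rw [dotProduct_fisher_mulVec]
  refine (le_sum_mul_inner_sq (w := fun i => M.w ⟪z n i, β₀ n⟫) (w' := fun i => M.w ⟪z n i, β⟫)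
    (δ := β - β₀ n) hA hC hW hsn hz.lower hz.upper hz.fourth (fun i => ?_) hwW
    ((mul_le_mul_of_nonneg_left hβ (by positivity)).trans hsmall) x).trans (le_of_eq ?_)
  · rw [inner_sub_right]
    exact abs_w_sub_le hw (hseg i)
  · exact Finset.sum_congr rfl fun i _ => by ring

include hu in
/-- Up to an error of order `p n / √n`, a Fisher scoring step is linear in the errors. -/
lemma exists_eventually_abs_linearization_le {K : ℝ} (hK : 0 ≤ K) :
    ∃ K' : ℝ, ∀ᶠ n : ℕ in atTop, ∀ (y : Fin n → ℝ) (β β₁ g : EuclideanSpace ℝ (Fin (p n))),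
      M.SolvesScoring (z n) y β β₁ → ‖β - β₀ n‖ ≤ K * √((p n : ℝ) / n) →
      ‖∑ i, (deriv M.u ⟪z n i, β₀ n⟫ * (y i - M.h ⟪z n i, β₀ n⟫)) • z n i‖
        ≤ K * (√(n : ℝ) ^ 2 * √((p n : ℝ) / n)) →
      ∑ i, (1 * (y i - M.h ⟪z n i, β₀ n⟫)) ^ 2 ≤ (K * √(n : ℝ)) ^ 2 →
      √(n : ℝ) * ‖g‖ ≤ K →
      ‖∑ i, (iteratedDeriv 2 M.u ⟪z n i, β₀ n⟫ * ⟪z n i, g⟫ * (y i - M.h ⟪z n i, β₀ n⟫)) • z n i‖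
        ≤ K * (√(n : ℝ) * √((p n : ℝ) / n)) →
      ∑ i, (⟪z n i, g⟫ * (y i - M.h ⟪z n i, β₀ n⟫)) ^ 2 ≤ (K * 1) ^ 2 →
      |g.ofLp ⬝ᵥ (M.fisher (z n) (β₀ n) *ᵥ (β₁ - β₀ n).ofLp) -
        M.φ⁻¹ * ∑ i, deriv M.u ⟪z n i, β₀ n⟫ * ⟪z n i, g⟫ * (y i - M.h ⟪z n i, β₀ n⟫)|
        ≤ K' * (√(n : ℝ) * √((p n : ℝ) / n) ^ 2) := by
  have hφ := M.φ_pos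
  -- One constant for the Lipschitz bounds of w and u', the Taylor bound of u', and the remainder C²
  -- + φ C of u' times the increment of h.
  set L : ℝ := C + (C ^ 2 + M.φ * C) with hL
  have hL0 : 0 ≤ L := by positivity
  have hCL : C ≤ L := by rw [hL]; linarith [show 0 ≤ C ^ 2 + M.φ * C by positivity]
  set K₁ : ℝ := 2 / (c * W) * M.φ⁻¹ * (K + L * A * K ^ 2 + L * A ^ 2 * K ^ 2)
  refine ⟨L * A ^ 2 * K ^ 2 * K₁ + M.φ⁻¹ * (K ^ 2 + L * A * K ^ 3 + L * A ^ 2 * K ^ 3), ?_⟩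
  have hsmall : ∀ᶠ n : ℕ in atTop, L * A ^ 2 * (K * √((p n : ℝ) / n)) ≤ c * W / 2 := by
    have : Tendsto (fun n : ℕ => L * A ^ 2 * (K * √((p n : ℝ) / n))) atTop (𝓝 0) := by
      simpa using (hr.const_mul K).const_mul (L * A ^ 2)
    exact this.eventually_le_const (by positivity)
  filter_upwards [hz, hB K, hwW, hsmall, hr.eventually_le_const one_pos, eventually_gt_atTop 0] with
    n hz hB hwW hsmall hr1 hn y β β₁ g hsol hβ hS he hg hG hge
  have hsn : 0 < √(n : ℝ) := Real.sqrt_pos.2 (by exact_mod_cast hn)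
  have hr0 : 0 ≤ √((p n : ℝ) / n) := Real.sqrt_nonneg _
  have hseg := fun i => boundedAt_of_mem_uIcc (fun δ hδ => hB δ hδ i) hβ
  simp only [add_sub_cancel] at hseg
  have heq := hsol.sum_smul_eq
  rw [← sub_sub_sub_cancel_right β₁ β (β₀ n)] at heq
  -- The residual at β is the true error minus the increment of h; these play the roles of e and d
  -- in the deterministic estimates.
  have hsplit : ∀ i, y i - M.h ⟪z n i, β⟫ =
      (y i - M.h ⟪z n i, β₀ n⟫) - (M.h ⟪z n i, β⟫ - M.h ⟪z n i, β₀ n⟫) := fun i => by ring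
  simp only [hsplit] at heq
  have bw : ∀ i, |M.w ⟪z n i, β⟫ - M.w ⟪z n i, β₀ n⟫| ≤ L * |⟪z n i, β - β₀ n⟫| := fun i => by
    rw [inner_sub_right]
    exact (abs_w_sub_le hw (hseg i)).trans (mul_le_mul_of_nonneg_right hCL (abs_nonneg _))
  have bu : ∀ i, |deriv M.u ⟪z n i, β⟫ - deriv M.u ⟪z n i, β₀ n⟫| ≤ L * |⟪z n i, β - β₀ n⟫| :=
    fun i => by
      rw [inner_sub_right]
      exact (abs_deriv_u_sub_le hu (hseg i)).trans (mul_le_mul_of_nonneg_right hCL (abs_nonneg _))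
  have bu2 : ∀ i, |deriv M.u ⟪z n i, β⟫ - deriv M.u ⟪z n i, β₀ n⟫ -
      iteratedDeriv 2 M.u ⟪z n i, β₀ n⟫ * ⟪z n i, β - β₀ n⟫| ≤ L * ⟪z n i, β - β₀ n⟫ ^ 2 :=
    fun i => by
      rw [inner_sub_right]
      exact (abs_deriv_u_sub_sub_le hu (hseg i)).trans
        (mul_le_mul_of_nonneg_right hCL (sq_nonneg _))
  have bd : ∀ i, |deriv M.u ⟪z n i, β⟫ * (M.h ⟪z n i, β⟫ - M.h ⟪z n i, β₀ n⟫) -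
      M.φ * M.w ⟪z n i, β⟫ * ⟪z n i, β - β₀ n⟫| ≤ L * ⟪z n i, β - β₀ n⟫ ^ 2 :=
    fun i => by
      rw [inner_sub_right]
      exact (abs_deriv_u_mul_h_sub_le hu hw (hseg i)).trans
        (mul_le_mul_of_nonneg_right (by rw [hL]; linarith) (sq_nonneg _))
  have hx := norm_scoring_step_le hφ hc hA hL0 hW hK hsn hr0 hr1 hz.lower hz.upper hz.fourth
    bw hwW bu bd heq hβ (by rwa [← mul_assoc] at hS) (by simpa only [one_mul] using he) hsmall
  have hlin := abs_scoring_linearization_le hφ hA hL0 hK (by positivity) hsn hr0 hz.upper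
    hz.fourth bw bu2 bd heq hβ hx hg (by rwa [← mul_assoc] at hG) (by simpa only [mul_one] using hge)
  rw [dotProduct_fisher_mulVec]
  exact hlin

end Rates

section Errors

variable {Ω : ℕ → Type*} [∀ n, MeasurableSpace (Ω n)] {P : ∀ n, Measure (Ω n)}
  [∀ n, IsProbabilityMeasure (P n)] {y : ∀ n, Fin n → Ω n → ℝ}

/-- The tail bounds for the linear and quadratic error terms of a Fisher scoring step. -/
lemma exists_eventually_error_tails (hy : M.IsSample z β₀ P y) {A C c c₂ κ : ℝ} (hA : 0 ≤ A)
    (_ : 0 ≤ C) (hc₂ : 0 ≤ c₂) (_ : 0 ≤ κ)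
    (hz : ∀ᶠ n in atTop, DesignBounds (z n) c A)
    (hB : ∀ᶠ n in atTop, ∀ i, M.BoundedAt C ⟪z n i, β₀ n⟫)
    (hv : ∀ᶠ n in atTop, ∀ i, M.v ⟪z n i, β₀ n⟫ ≤ c₂) (hp : ∀ᶠ n in atTop, 1 ≤ p n)
    {g : ∀ n, EuclideanSpace ℝ (Fin (p n))} (hg : ∀ᶠ n : ℕ in atTop, √(n : ℝ) * ‖g n‖ ≤ κ) :
    ∃ Γ : ℝ, 0 ≤ Γ ∧ ∀ᶠ n : ℕ in atTop, ∀ K : ℝ, 0 < K →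
      (P n).real {ω | K * (√(n : ℝ) ^ 2 * √((p n : ℝ) / n)) <
        ‖∑ i, (deriv M.u ⟪z n i, β₀ n⟫ * (y n i ω - M.h ⟪z n i, β₀ n⟫)) • z n i‖} ≤ Γ / K ^ 2 ∧
      (P n).real {ω | (K * √(n : ℝ)) ^ 2 < ∑ i, (1 * (y n i ω - M.h ⟪z n i, β₀ n⟫)) ^ 2}
        ≤ Γ / K ^ 2 ∧
      (P n).real {ω | K * (√(n : ℝ) * √((p n : ℝ) / n)) <
        ‖∑ i, (iteratedDeriv 2 M.u ⟪z n i, β₀ n⟫ * ⟪z n i, g n⟫ *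
          (y n i ω - M.h ⟪z n i, β₀ n⟫)) • z n i‖} ≤ Γ / K ^ 2 ∧
      (P n).real {ω | (K * 1) ^ 2 < ∑ i, (⟪z n i, g n⟫ * (y n i ω - M.h ⟪z n i, β₀ n⟫)) ^ 2}
        ≤ Γ / K ^ 2 := by
  -- One summand for each of the four second moments, using ‖z_i‖² ≤ A² p, variances at most c₂ and
  -- ∑ ⟨z_i, g⟩² ≤ (A κ)².
  set Γ : ℝ := C ^ 2 * A ^ 2 * c₂ + c₂ + C ^ 2 * A ^ 2 * c₂ * (A * κ) ^ 2 + c₂ * (A * κ) ^ 2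
    with hΓ
  have q1 : 0 ≤ C ^ 2 * A ^ 2 * c₂ := by positivity
  have q2 : 0 ≤ C ^ 2 * A ^ 2 * c₂ * (A * κ) ^ 2 := by positivity
  have q3 : 0 ≤ c₂ * (A * κ) ^ 2 := by positivity
  refine ⟨Γ, by positivity, ?_⟩
  filter_upwards [hz, hB, hv, hp, hg, eventually_gt_atTop 0] with n hz hB hv hp hg hn K hK
  have hn' : (0 : ℝ) < n := by exact_mod_cast hn
  have hp' : (0 : ℝ) < p n := by exact_mod_cast hp
  have hsn : 0 < √(n : ℝ) := Real.sqrt_pos.2 hn'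
  have hs2 : √(n : ℝ) ^ 2 = n := Real.sq_sqrt hn'.le
  have hr0 : 0 < √((p n : ℝ) / n) := Real.sqrt_pos.2 (by positivity)
  have hr2 : √((p n : ℝ) / n) ^ 2 = p n / n := Real.sq_sqrt (by positivity)
  set e : Fin n → Ω n → ℝ := fun i ω => y n i ω - M.h ⟪z n i, β₀ n⟫ with he
  have hL : ∀ i, MemLp (e i) 2 (P n) := fun i =>
    memLp_error (hy.measurable n i) (hy.map_eq n i) (hB i).mem
  have h0 : ∀ i, ∫ ω, e i ω ∂(P n) = 0 := fun i =>
    integral_error (hy.measurable n i) (hy.map_eq n i) (hB i).mem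
  have h2 : ∀ i, ∫ ω, e i ω ^ 2 ∂(P n) ≤ c₂ := fun i =>
    (integral_error_sq (hy.measurable n i) (hy.map_eq n i) (hB i).mem).le.trans (hv i)
  have h2' : ∀ i, 0 ≤ ∫ ω, e i ω ^ 2 ∂(P n) := fun i => integral_nonneg fun _ => sq_nonneg _
  have hind : Pairwise fun i j => IndepFun (e i) (e j) (P n) := fun i j hij =>
    ((hy.indep n).comp (fun i x => x - M.h ⟪z n i, β₀ n⟫) fun i => by fun_prop).indepFun hij
  have hzn : ∀ i, ‖z n i‖ ^ 2 ≤ A ^ 2 * p n := fun i => by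
    calc ‖z n i‖ ^ 2 ≤ (A * √(p n : ℝ)) ^ 2 := by have := hz.norm_le i; gcongr
      _ = _ := by rw [mul_pow, Real.sq_sqrt hp'.le]
  have hu1 : ∀ i, deriv M.u ⟪z n i, β₀ n⟫ ^ 2 ≤ C ^ 2 := fun i => by
    rw [← sq_abs]; have := (hB i).deriv_u; gcongr
  have hu2 : ∀ i, iteratedDeriv 2 M.u ⟪z n i, β₀ n⟫ ^ 2 ≤ C ^ 2 := fun i => by
    rw [← sq_abs]; have := (hB i).deriv2_u; gcongr
  have hζ : ∑ i, ⟪z n i, g n⟫ ^ 2 ≤ (A * κ) ^ 2 := by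
    refine (hz.upper (g n)).trans ?_
    rw [mul_assoc]
    gcongr
  refine ⟨?_, ?_, ?_, ?_⟩
  · refine measureReal_lt_norm_sum_smul_le hL hind h0 _ _ (by positivity) hK ?_
    calc _ ≤ ∑ _i : Fin n, C ^ 2 * (A ^ 2 * p n) * c₂ := by
          refine Finset.sum_le_sum fun i _ => ?_
          have := hu1 i; have := hzn i; have := h2 i; have := h2' i
          gcongr
      _ = C ^ 2 * A ^ 2 * c₂ * (√(n : ℝ) ^ 2 * √((p n : ℝ) / n)) ^ 2 := by
          rw [mul_pow, hr2, hs2]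
          simp only [Finset.sum_const, Finset.card_univ, Fintype.card_fin, nsmul_eq_mul]
          field_simp
      _ ≤ _ := mul_le_mul_of_nonneg_right (by linarith) (sq_nonneg _)
  · refine measureReal_lt_sum_sq_le hL _ hsn hK ?_
    calc _ ≤ ∑ _i : Fin n, c₂ := by
          refine Finset.sum_le_sum fun i _ => ?_
          rw [one_pow, one_mul]; exact h2 i
      _ = c₂ * √(n : ℝ) ^ 2 := by
          rw [hs2]
          simp only [Finset.sum_const, Finset.card_univ, Fintype.card_fin, nsmul_eq_mul]
          ring
      _ ≤ _ := mul_le_mul_of_nonneg_right (by linarith) (sq_nonneg _)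
  · refine measureReal_lt_norm_sum_smul_le hL hind h0 _ _ (by positivity) hK ?_
    calc _ ≤ ∑ i, (C ^ 2 * ⟪z n i, g n⟫ ^ 2) * (A ^ 2 * p n) * c₂ := by
          refine Finset.sum_le_sum fun i _ => ?_
          rw [mul_pow]
          have := hu2 i; have := hzn i; have := h2 i; have := h2' i
          gcongr
      _ = (C ^ 2 * A ^ 2 * c₂ * ∑ i, ⟪z n i, g n⟫ ^ 2) * p n := by
          rw [Finset.mul_sum, Finset.sum_mul]
          exact Finset.sum_congr rfl fun i _ => by ring
      _ ≤ (C ^ 2 * A ^ 2 * c₂ * (A * κ) ^ 2) * p n := by gcongr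
      _ = (C ^ 2 * A ^ 2 * c₂ * (A * κ) ^ 2) * (√(n : ℝ) * √((p n : ℝ) / n)) ^ 2 := by
          rw [mul_pow √(n : ℝ), hr2, hs2]
          field_simp
      _ ≤ _ := mul_le_mul_of_nonneg_right (by linarith) (sq_nonneg _)
  · refine measureReal_lt_sum_sq_le hL _ one_pos hK ?_
    calc _ ≤ ∑ i, ⟪z n i, g n⟫ ^ 2 * c₂ := by
          refine Finset.sum_le_sum fun i _ => ?_
          exact mul_le_mul_of_nonneg_left (h2 i) (sq_nonneg _)
      _ = c₂ * ∑ i, ⟪z n i, g n⟫ ^ 2 := by rw [← Finset.sum_mul, mul_comm]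
      _ ≤ c₂ * (A * κ) ^ 2 * 1 ^ 2 := by rw [one_pow, mul_one]; gcongr
      _ ≤ _ := mul_le_mul_of_nonneg_right (by linarith) (sq_nonneg _)

end Errors

end GLM

/-! ### Invertibility and asymptotic normality -/

lemma tendsto_sqrt_div_of_isLittleO {p : ℕ → ℕ}
    (hp : (fun n => (p n : ℝ)) =o[atTop] (fun n : ℕ => (n : ℝ))) :
    Tendsto (fun n : ℕ => √((p n : ℝ) / n)) atTop (𝓝 0) := by
  simpa using hp.tendsto_div_nhds_zero.sqrt

namespace GLM

lemma measurableSet_solvesScoring {M : GLM} (hD : M.D.Nonempty) {n p : ℕ}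
    {z : Fin n → EuclideanSpace ℝ (Fin p)} {Ω : Type*} [MeasurableSpace Ω] {y : Fin n → Ω → ℝ}
    (hy : ∀ i, Measurable (y i)) {β β₁ : Ω → EuclideanSpace ℝ (Fin p)} (hβ : Measurable β)
    (hβ₁ : Measurable β₁) :
    MeasurableSet {ω | M.SolvesScoring z (fun i => y i ω) (β ω) (β₁ ω)} := by
  have h1 : ∀ j k, Measurable fun ω => M.fisher z (β ω) j k := fun j k =>
    (M.measurable_fisher_apply hD z j k).comp hβ
  have hm : Measurable fun ω => ((fun i => y i ω : Fin n → ℝ), β ω) :=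
    (measurable_pi_lambda (fun ω i => y i ω) hy).prodMk hβ
  have h2 := (M.measurable_score z).comp hm
  simp only [Function.comp_def] at h2
  have h3 : ∀ {f : Ω → EuclideanSpace ℝ (Fin p)}, Measurable f → ∀ k, Measurable fun ω => f ω k :=
    fun hf k => (measurable_pi_apply k).comp ((WithLp.measurable_ofLp 2 _).comp hf)
  have h4 : {ω | M.SolvesScoring z (fun i => y i ω) (β ω) (β₁ ω)} =
      ⋂ j, {ω | ∑ k, M.fisher z (β ω) j k * (β₁ ω - β ω) k =
        M.score z (fun i => y i ω) (β ω) j} := by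
    ext ω
    simp only [Set.mem_ofPred_eq, Set.mem_iInter, SolvesScoring, funext_iff, Matrix.mulVec,
      dotProduct]
  rw [h4]
  exact MeasurableSet.iInter fun j => measurableSet_eq_fun
    (Finset.measurable_fun_sum _ fun k _ => (h1 j k).mul (h3 (hβ₁.sub hβ) k)) (h3 h2 j)

variable {M : GLM} {p : ℕ → ℕ} {z : ∀ n, Fin n → EuclideanSpace ℝ (Fin (p n))}
  {β₀ : ∀ n, EuclideanSpace ℝ (Fin (p n))} {B : ∀ n, Set (EuclideanSpace ℝ (Fin (p n)))}
  {Ω : ℕ → Type*} [∀ n, MeasurableSpace (Ω n)] {P : ∀ n, Measure (Ω n)}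
  [∀ n, IsProbabilityMeasure (P n)] {y : ∀ n, Fin n → Ω n → ℝ}

/-- Sample size 1 is the first that has an observation, hence a predictor to exhibit. -/
lemma ParameterSpaces.nonempty_D (hPar : M.ParameterSpaces z β₀ B) : M.D.Nonempty :=
  ⟨_, hPar.admissible 1 0 _ (interior_subset (hPar.interior 1))⟩

lemma ParameterSpaces.inner_mem_D (hPar : M.ParameterSpaces z β₀ B) (n : ℕ) (i : Fin n) :
    ⟪z n i, β₀ n⟫ ∈ M.D :=
  hPar.admissible n i _ (interior_subset (hPar.interior n))

omit [∀ n, IsProbabilityMeasure (P n)] in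
/-- `u'` is bounded away from zero at the true linear predictors, and the variances of the
responses are bounded. -/
lemma exists_eventually_le_abs_deriv_u (hy : M.IsSample z β₀ P y)
    (hErr : M.BoundedErrorVariance z β₀ P y) (hPar : M.ParameterSpaces z β₀ B)
    (hu : ContDiffOn ℝ 3 M.u M.D) {W : ℝ} (hW : 0 < W)
    (hwW : ∀ᶠ n in atTop, ∀ i, W ≤ M.w ⟪z n i, β₀ n⟫) :
    ∃ c₀ c₂ : ℝ, 0 < c₀ ∧ 0 ≤ c₂ ∧ (∀ᶠ n in atTop, ∀ i, c₀ ≤ |deriv M.u ⟪z n i, β₀ n⟫|) ∧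
      ∀ᶠ n in atTop, ∀ i, M.v ⟪z n i, β₀ n⟫ ≤ c₂ := by
  obtain ⟨c, hc⟩ := hErr
  have hφ := M.φ_pos
  set c₂ : ℝ := |c| + 1 with hc₂
  have hc₂0 : 0 < c₂ := by positivity
  have hv : ∀ᶠ n in atTop, ∀ i, M.v ⟪z n i, β₀ n⟫ ≤ c₂ := by
    filter_upwards [hc] with n hn i
    rw [← integral_error_sq (hy.measurable n i) (hy.map_eq n i) (hPar.inner_mem_D n i)]
    exact (hn i).trans (by linarith [le_abs_self c])
  -- From W ≤ w = (u'/φ)² v ≤ (u'/φ)² c₂.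
  refine ⟨M.φ * √(W / c₂), c₂, by positivity, hc₂0.le, ?_, hv⟩
  filter_upwards [hv, hwW] with n h1 h2 i
  have h3 := h2 i
  rw [w_eq hu (hPar.inner_mem_D n i)] at h3
  have h4 : W / c₂ ≤ (M.φ⁻¹ * deriv M.u ⟪z n i, β₀ n⟫) ^ 2 := by
    rw [div_le_iff₀ hc₂0]
    exact h3.trans (mul_le_mul_of_nonneg_left (h1 i) (sq_nonneg _))
  have h5 := Real.abs_le_sqrt (x := √(W / c₂)) (y := (M.φ⁻¹ * deriv M.u ⟪z n i, β₀ n⟫) ^ 2)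
    (by rwa [Real.sq_sqrt (by positivity)])
  rw [abs_of_nonneg (Real.sqrt_nonneg _), Real.sqrt_sq_eq_abs, abs_mul,
    abs_of_pos (inv_pos.2 hφ), inv_mul_eq_div, le_div_iff₀ hφ] at h5
  linarith

/-- The Fisher information at a `√(n / p n)`-consistent estimator is invertible with probability
tending to one. -/
theorem tendsto_measure_isUnit_fisher (hEig : DesignEigenvalueBounds z)
    (hMom : DesignMomentBounds z) (hPar : M.ParameterSpaces z β₀ B) (hReg : M.Regular z β₀ B)
    {βhat : ∀ n, Ω n → EuclideanSpace ℝ (Fin (p n))} (hcons : RootConsistent β₀ P βhat)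
    (hp : (fun n => (p n : ℝ)) =o[atTop] (fun n : ℕ => (n : ℝ))) :
    Tendsto (fun n => P n {ω | IsUnit (M.fisher (z n) (βhat n ω))}) atTop (𝓝 1) := by
  obtain ⟨c, A, hc, hA, hz⟩ := exists_eventually_designBounds hEig hMom
  obtain ⟨C, hC, hB⟩ := exists_eventually_boundedAt hPar hReg
  obtain ⟨W, hW, hwW⟩ := hReg.w_lower
  refine tendsto_measure_one_of_compl_le fun ε hε => ?_
  obtain ⟨K, hK⟩ := hcons ε hε
  filter_upwards [hK, eventually_le_fisher hReg.w_contDiffOn hA hC hc hW hz hB hwW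
    (tendsto_sqrt_div_of_isLittleO hp) K, eventually_gt_atTop 0] with n h1 h2 hn
  have hn' : (0 : ℝ) < n := by exact_mod_cast hn
  refine (measure_mono fun ω hω => ?_).trans h1
  by_contra hle
  refine hω (isUnit_of_dotProduct_mulVec_pos fun x hx => ?_)
  have hx' := norm_pos_iff.2 hx
  exact lt_of_lt_of_le (by positivity) (h2 _ (not_lt.1 hle) x)

/-- Asymptotic normality of Fisher scoring steps. -/
theorem tendstoInDistribution_scoring (hy : M.IsSample z β₀ P y)
    (hEig : DesignEigenvalueBounds z) (hMom : DesignMomentBounds z)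
    (hErr : M.BoundedErrorVariance z β₀ P y)
    (hPar : M.ParameterSpaces z β₀ B) (hReg : M.Regular z β₀ B)
    {βhat0 : ∀ n, Ω n → EuclideanSpace ℝ (Fin (p n))}
    (hβhat0 : ∀ n, Measurable (βhat0 n)) (hcons : RootConsistent β₀ P βhat0)
    (hp : (fun n => (p n : ℝ)) =o[atTop] (fun n : ℕ => √(n : ℝ)))
    {βhat1 : ∀ n, Ω n → EuclideanSpace ℝ (Fin (p n))} (hβhat1 : ∀ n, Measurable (βhat1 n))
    (hsol : Tendsto (fun n => P n {ω | M.SolvesScoring (z n) (fun i => y n i ω) (βhat0 n ω)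
      (βhat1 n ω)}) atTop (𝓝 1))
    {α : ∀ n, EuclideanSpace ℝ (Fin (p n))} (hα : ∀ᶠ n in atTop, ‖α n‖ = 1) :
    TendstoInDistribution
      (fun n ω => (α n).ofLp ⬝ᵥ (M.sqrtFisher (z n) (β₀ n) *ᵥ (βhat1 n ω - β₀ n).ofLp))
      atTop (id : ℝ → ℝ) P (gaussianReal 0 1) := by
  obtain ⟨c, A, hc, hA, hz⟩ := exists_eventually_designBounds hEig hMom
  obtain ⟨C, hC, hB⟩ := exists_eventually_boundedAt hPar hReg
  obtain ⟨W, hW, hwW⟩ := hReg.w_lower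
  have hu := hReg.u_contDiffOn
  have hw := hReg.w_contDiffOn
  obtain ⟨c₀, c₂, hc₀, hc₂, hlow, hv⟩ := exists_eventually_le_abs_deriv_u hy hErr hPar hu hW hwW
  have hsqrt : (fun n : ℕ => √(n : ℝ)) =O[atTop] (fun n : ℕ => (n : ℝ)) := by
    refine IsBigO.of_bound 1 ?_
    filter_upwards [eventually_ge_atTop 1] with n hn
    have hn' : (1 : ℝ) ≤ n := by exact_mod_cast hn
    rw [Real.norm_of_nonneg (Real.sqrt_nonneg _), Real.norm_of_nonneg (by linarith), one_mul]
    exact Real.sqrt_le_self_iff.2 (Or.inr hn')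
  have hr := tendsto_sqrt_div_of_isLittleO (hp.trans_isBigO hsqrt)
  have hsr : Tendsto (fun n : ℕ => √(n : ℝ) * √((p n : ℝ) / n) ^ 2) atTop (𝓝 0) := by
    refine hp.tendsto_div_nhds_zero.congr' ?_
    filter_upwards [eventually_gt_atTop 0] with n hn
    have hn' : (0 : ℝ) < n := by exact_mod_cast hn
    rw [Real.sq_sqrt (by positivity)]
    have h1 := Real.sq_sqrt hn'.le
    have h2 : 0 < √(n : ℝ) := Real.sqrt_pos.2 hn'
    rw [mul_div_assoc', div_eq_div_iff h2.ne' hn'.ne']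
    linear_combination (-(p n : ℝ)) * h1
  -- Dimension zero has no unit vectors.
  have hp1 : ∀ᶠ n in atTop, 1 ≤ p n := by
    filter_upwards [hα] with n hn
    by_contra! h0
    have hE : IsEmpty (Fin (p n)) := by
      rw [Nat.lt_one_iff.1 h0]; infer_instance
    rw [Subsingleton.elim (α n) 0, norm_zero] at hn
    exact zero_ne_one hn
  have hF := eventually_le_fisher hw hA hC hc hW hz hB hwW hr 0
  -- g = F^(-1/2) α where the information is positive definite, which holds for large n; elsewhere
  -- the value 0 makes the choice total.
  have hex : ∀ n, ∃ g : EuclideanSpace ℝ (Fin (p n)),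
      (∀ x : EuclideanSpace ℝ (Fin (p n)), x ≠ 0 →
        0 < x.ofLp ⬝ᵥ (M.fisher (z n) (β₀ n) *ᵥ x.ofLp)) →
      g.ofLp ⬝ᵥ (M.fisher (z n) (β₀ n) *ᵥ g.ofLp) = ‖α n‖ ^ 2 ∧
      ∀ x : EuclideanSpace ℝ (Fin (p n)), (α n).ofLp ⬝ᵥ (M.sqrtFisher (z n) (β₀ n) *ᵥ x.ofLp)
        = g.ofLp ⬝ᵥ (M.fisher (z n) (β₀ n) *ᵥ x.ofLp) := by
    intro n
    by_cases h : ∀ x : EuclideanSpace ℝ (Fin (p n)), x ≠ 0 →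
        0 < x.ofLp ⬝ᵥ (M.fisher (z n) (β₀ n) *ᵥ x.ofLp)
    · obtain ⟨g, hg⟩ := exists_sqrt_mulVec_eq (isHermitian_sum_smul_vecMulVec _ _) h (α n)
      exact ⟨g, fun _ => hg⟩
    · exact ⟨0, fun h' => absurd h' h⟩
  choose g hg using hex
  -- From (c W / 2) n ‖g‖² ≤ g · F g = 1.
  set κ : ℝ := √(2 / (c * W)) with hκ
  have hgood : ∀ᶠ n : ℕ in atTop, √(n : ℝ) * ‖g n‖ ≤ κ ∧
      ∑ i, M.w ⟪z n i, β₀ n⟫ * ⟪z n i, g n⟫ ^ 2 = 1 ∧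
      ∀ x : EuclideanSpace ℝ (Fin (p n)), (α n).ofLp ⬝ᵥ (M.sqrtFisher (z n) (β₀ n) *ᵥ x.ofLp)
        = (g n).ofLp ⬝ᵥ (M.fisher (z n) (β₀ n) *ᵥ x.ofLp) := by
    filter_upwards [hF, hα, eventually_gt_atTop 0] with n hF hα hn
    have hn' : (0 : ℝ) < n := by exact_mod_cast hn
    have h1 := hF (β₀ n) (by simp)
    obtain ⟨h2, h3⟩ := hg n fun x hx => by
      have hx' := norm_pos_iff.2 hx
      exact lt_of_lt_of_le (by positivity) (h1 x)
    rw [hα, one_pow] at h2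
    refine ⟨?_, ?_, h3⟩
    · have h4 := h1 (g n)
      rw [h2] at h4
      refine Real.le_sqrt_of_sq_le ?_
      rw [le_div_iff₀ (by positivity)]
      linarith
    · rw [dotProduct_fisher_mulVec] at h2
      rw [← h2]
      exact Finset.sum_congr rfl fun i _ => by ring
  have hgκ := hgood.mono fun n h => h.1
  have hB0 : ∀ᶠ n in atTop, ∀ i, M.BoundedAt C ⟪z n i, β₀ n⟫ := by
    filter_upwards [hB 0] with n hn i
    simpa using hn 0 (by simp) i
  have hscore := tendstoInDistribution_score hy hu hw hA hC hc₀ (Real.sqrt_nonneg _) hz hB hlow hr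
    hp1 hgκ (hgood.mono fun n h => h.2.1)
  have hmeas : ∀ n, Measurable fun ω =>
      (α n).ofLp ⬝ᵥ (M.sqrtFisher (z n) (β₀ n) *ᵥ (βhat1 n ω - β₀ n).ofLp) := by
    intro n
    have h1 : ∀ k, Measurable fun ω => (βhat1 n ω - β₀ n).ofLp k := fun k =>
      (measurable_pi_apply k).comp ((WithLp.measurable_ofLp 2 _).comp ((hβhat1 n).sub_const _))
    simp only [Matrix.mulVec, dotProduct]
    exact Finset.measurable_fun_sum _ fun j _ =>
      (Finset.measurable_fun_sum _ fun k _ => (h1 k).const_mul _).const_mul _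
  refine tendstoInDistribution_of_tendsto_measure_sub hscore (fun n => (hmeas n).aemeasurable)
    fun ε hε => ?_
  obtain ⟨Γ, hΓ, htails⟩ := exists_eventually_error_tails hy hA hC hc₂ (Real.sqrt_nonneg _) hz hB0
    hv hp1 hgκ
  refine tendsto_order.2 ⟨fun a ha => Eventually.of_forall fun n => ha.trans_le measureReal_nonneg,
    fun ρ hρ => ?_⟩
  obtain ⟨K₀, hK₀⟩ := hcons (ρ / 4) (by positivity)
  -- K dominates K₀, κ and 1, and K² ≥ K ≥ 16 Γ / ρ makes each of the four error tails at most ρ /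
  -- 16.
  set K : ℝ := |K₀| + κ + 1 + 16 * Γ / ρ with hKdef
  have hκ0 : 0 ≤ κ := Real.sqrt_nonneg _
  have hΓρ : 0 ≤ 16 * Γ / ρ := by positivity
  have hKκ : κ ≤ K := by linarith [abs_nonneg K₀]
  have hK1 : 1 ≤ K := by linarith [abs_nonneg K₀]
  have hKK₀ : K₀ ≤ K := by linarith [le_abs_self K₀]
  have hKΓ : Γ / K ^ 2 ≤ ρ / 16 := by
    rw [div_le_iff₀ (by positivity)]
    have h1 : 16 * Γ / ρ ≤ K ^ 2 := by nlinarith [abs_nonneg K₀]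
    rw [div_le_iff₀ hρ] at h1
    linarith
  obtain ⟨K', hK'⟩ := exists_eventually_abs_linearization_le hu hw hA hC hc hW hz hB hwW hr
    (zero_le_one.trans hK1)
  have hsolc : ∀ᶠ n in atTop, (P n).real {ω | M.SolvesScoring (z n) (fun i => y n i ω)
      (βhat0 n ω) (βhat1 n ω)}ᶜ < ρ / 4 := by
    have h1 : Tendsto (fun n => (P n).real {ω | M.SolvesScoring (z n) (fun i => y n i ω)
        (βhat0 n ω) (βhat1 n ω)}) atTop (𝓝 1) :=
      (ENNReal.tendsto_toReal ENNReal.one_ne_top).comp hsol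
    filter_upwards [h1.eventually (lt_mem_nhds (show 1 - ρ / 4 < 1 by linarith))] with n hn
    rw [probReal_compl_eq_one_sub (measurableSet_solvesScoring hPar.nonempty_D (hy.measurable n)
      (hβhat0 n) (hβhat1 n))]
    linarith
  have hsmall : ∀ᶠ n : ℕ in atTop, K' * (√(n : ℝ) * √((p n : ℝ) / n) ^ 2) ≤ ε := by
    have : Tendsto (fun n : ℕ => K' * (√(n : ℝ) * √((p n : ℝ) / n) ^ 2)) atTop (𝓝 0) := by
      simpa using hsr.const_mul K'
    exact this.eventually_le_const hε
  filter_upwards [hK₀, hK', hsolc, hsmall, htails, hgood] with n hK₀ hK' hsolc hsmall htails hgood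
  obtain ⟨t1, t2, t3, t4⟩ := htails K (by linarith)
  have t0 : (P n).real {ω | K₀ * √((p n : ℝ) / n) < ‖βhat0 n ω - β₀ n‖} ≤ ρ / 4 :=
    ENNReal.toReal_le_of_le_ofReal (by positivity) hK₀
  -- The exceptional events have total probability at most ρ/4 + ρ/4 + 4 · ρ/16 < ρ. Outside them
  -- the deterministic linearization applies to the outcome ω.
  have hle := (measureReal_union_le _ _).trans (add_le_add hsolc.le
    ((measureReal_union_le _ _).trans (add_le_add t0
      ((measureReal_union_le _ _).trans (add_le_add (t1.trans hKΓ)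
        ((measureReal_union_le _ _).trans (add_le_add (t2.trans hKΓ)
          ((measureReal_union_le _ _).trans (add_le_add (t3.trans hKΓ) (t4.trans hKΓ))))))))))
  refine lt_of_le_of_lt ((measureReal_mono fun ω (hω : ε < _) => ?_).trans hle) (by linarith)
  by_contra hmem
  simp only [Set.mem_union, not_or, Set.mem_compl_iff, not_not, Set.mem_ofPred_eq, not_lt] at hmem
  obtain ⟨m0, m1, m2, m3, m4, m5⟩ := hmem
  have h1 := hK' (fun i => y n i ω) (βhat0 n ω) (βhat1 n ω) (g n) m0
    (m1.trans (mul_le_mul_of_nonneg_right hKK₀ (Real.sqrt_nonneg _))) m2 m3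
    (hgood.1.trans hKκ) m4 m5
  rw [← hgood.2.2] at h1
  linarith

end GLM

theorem theorem2 (M : GLM) (p : ℕ → ℕ)
    (z : ∀ n, Fin n → EuclideanSpace ℝ (Fin (p n)))
    (β₀ : ∀ n, EuclideanSpace ℝ (Fin (p n)))
    (B : ∀ n, Set (EuclideanSpace ℝ (Fin (p n))))
    {Ω : ℕ → Type*} [∀ n, MeasurableSpace (Ω n)]
    (P : ∀ n, Measure (Ω n)) [∀ n, IsProbabilityMeasure (P n)]
    (y : ∀ n, Fin n → Ω n → ℝ) (hy : M.IsSample z β₀ P y)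
    (hEig : DesignEigenvalueBounds z) (hMom : DesignMomentBounds z)
    (hErr : M.BoundedErrorVariance z β₀ P y)
    (hPar : M.ParameterSpaces z β₀ B) (hReg : M.Regular z β₀ B)
    (βhat0 : ∀ n, Ω n → EuclideanSpace ℝ (Fin (p n)))
    (hβhat0 : ∀ n, Measurable (βhat0 n)) (hcons : RootConsistent β₀ P βhat0) :
    ((fun n => (p n : ℝ)) =o[atTop] (fun n : ℕ => (n : ℝ)) →
      (∀ n, Measurable fun ω => M.oneStep (z n) (fun i => y n i ω) (βhat0 n ω)) ∧
      Tendsto (fun n => P n {ω | IsUnit (M.fisher (z n) (βhat0 n ω))}) atTop (𝓝 1) ∧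
      Tendsto (fun n => P n {ω | M.SolvesScoring (z n) (fun i => y n i ω) (βhat0 n ω)
        (M.oneStep (z n) (fun i => y n i ω) (βhat0 n ω))}) atTop (𝓝 1)) ∧
    ((fun n => (p n : ℝ)) =o[atTop] (fun n : ℕ => √(n : ℝ)) →
      ∀ βhat1 : ∀ n, Ω n → EuclideanSpace ℝ (Fin (p n)), (∀ n, Measurable (βhat1 n)) →
      Tendsto (fun n => P n {ω | M.SolvesScoring (z n) (fun i => y n i ω) (βhat0 n ω)
        (βhat1 n ω)}) atTop (𝓝 1) →
      ∀ α : ∀ n, EuclideanSpace ℝ (Fin (p n)), (∀ᶠ n in atTop, ‖α n‖ = 1) →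
      TendstoInDistribution
        (fun n ω => (α n).ofLp ⬝ᵥ (M.sqrtFisher (z n) (β₀ n) *ᵥ (βhat1 n ω - β₀ n).ofLp))
        atTop (id : ℝ → ℝ) P (gaussianReal 0 1)) := by
  refine ⟨fun hp => ⟨fun n => ?_, ?_, ?_⟩, fun hp βhat1 hβhat1 hsol α hα =>
    GLM.tendstoInDistribution_scoring hy hEig hMom hErr hPar hReg hβhat0 hcons hp hβhat1 hsol hα⟩
  · exact (M.measurable_oneStep hPar.nonempty_D (z n)).comp
      ((measurable_pi_lambda _ (hy.measurable n)).prodMk (hβhat0 n))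
  · exact GLM.tendsto_measure_isUnit_fisher hEig hMom hPar hReg hcons hp
  · exact tendsto_of_tendsto_of_tendsto_of_le_of_le
      (GLM.tendsto_measure_isUnit_fisher hEig hMom hPar hReg hcons hp) tendsto_const_nhds
      (fun n => measure_mono fun ω hω => GLM.solvesScoring_oneStep hω) fun n => prob_le_one
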